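/- For an indefinite real binary quadratic form $f(x,y)=ax^2+bxy+cy^2$ put $\delta(f)=b^2-4ac>0$, and for $M\in \mathrm{SL}_2(\mathbb R)$ let $f(M)$ be the value of $f$ at the first column $M\binom10$ of $M$. Let $\mathbf H_4\subset \mathrm{SL}_2(\mathbb R)$ be the Hecke group generated by $\begin{pmatrix}0&-1\\1&0\end{pmatrix}$ and $\begin{pmatrix}1&\sqrt2\\0&1\end{pmatrix}$. The Markoff and Lagrange spectra of $\mathbf H_4$ are the sets of real numbers $$\mathscr M(\mathbf H_4)=\Big\{\frac{\sqrt{\delta(f)}}{\inf_{M\in\mathbf H_4}|f(M)|}\ \Big|\ \delta(f)>0\Big\}\cap\mathbb R,\qquad \mathscr L(\mathbf H_4)=\Big\{\limsup_{M\in\mathbf H_4}\frac{\sqrt{\delta(f)}}{|f(M)|}\ \Big|\ \delta(f)>0\Big\}\cap\mathbb R .$$ Here a quotient with denominator $0$ is $\infty$, and the upper limit is taken over the distinct vectors $M\binom10$, $M\in\mathbf H_4$ (that is, it is the infimum over finite sets $F$ of vectors of the supremum over the vectors outside $F$). In $\mathscr L(\mathbf H_4)$ only those $f$ are considered that have a zero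 $u\in\mathbb R^2\setminus\{0\}$ proportional to none of the vectors $M\binom10$, $M\in\mathbf H_4$. Then for every $\varepsilon>0$, $$\dim_H\big(\mathscr M(\mathbf H_4)\cap[0,2\sqrt2+\varepsilon)\big)\ \ge\ \dim_H\big(\mathscr L(\mathbf H_4)\cap[0,2\sqrt2+\varepsilon)\big)\ >\ 0,$$ where $\dim_H$ is the Hausdorff dimension. -/

import Mathlib

open scoped ENNReal MatrixGroups

namespace HeckeSpectra

/-- A real binary quadratic form `f(x, y) = a x² + b x y + c y²`. -/
structure BinForm where
  a : ℝ
  b : ℝ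
  c : ℝ

/-- The value `f(v) = a x² + b x y + c y²` at the vector `v = (x, y)`. -/
def BinForm.eval (f : BinForm) (v : Fin 2 → ℝ) : ℝ :=
  f.a * v 0 ^ 2 + f.b * (v 0 * v 1) + f.c * v 1 ^ 2

/-- The discriminant `δ(f) = b² - 4ac`. -/
def BinForm.disc (f : BinForm) : ℝ := f.b ^ 2 - 4 * f.a * f.c

/-- The number `λ_q = 2 cos (π / q)`. -/
noncomputable def heckeLambda (q : ℕ) : ℝ := 2 * Real.cos (Real.pi / q)

/-- The matrix `S = (0, -1; 1, 0)`. -/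
def heckeS : SL(2, ℝ) := ⟨!![0, -1; 1, 0], by simp [Matrix.det_fin_two]⟩

/-- The matrix `T = (1, λ_q; 0, 1)`. -/
noncomputable def heckeT (q : ℕ) : SL(2, ℝ) :=
  ⟨!![1, heckeLambda q; 0, 1], by simp [Matrix.det_fin_two]⟩

/-- The Hecke group `H_q`, generated by `S` and `T` in `SL₂(ℝ)`. -/
noncomputable def heckeGroup (q : ℕ) : Subgroup SL(2, ℝ) :=
  Subgroup.closure {heckeS, heckeT q}

/-- The set of the vectors `M (1, 0)ᵗ` with `M ∈ G`. -/
def cuspOrbit (G : Subgroup SL(2, ℝ)) : Set (Fin 2 → ℝ) :=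
  {v | ∃ M ∈ G, v = Matrix.mulVec (M : Matrix (Fin 2) (Fin 2) ℝ) ![1, 0]}

/-- The infimum of `|f(M)| = |f(M (1, 0)ᵗ)|` over `M ∈ G`. -/
noncomputable def minOn (G : Subgroup SL(2, ℝ)) (f : BinForm) : ℝ :=
  ⨅ M : G, |f.eval (Matrix.mulVec ((M : SL(2, ℝ)) : Matrix (Fin 2) (Fin 2) ℝ) ![1, 0])|

/-- The (finite part of the) Markoff spectrum of `G`: the numbers `√δ(f) / inf_{M ∈ G} |f(M)|` with
`δ(f) > 0`. The forms whose infimum is `0` have the value `∞`, which is not a real number. -/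
def markoffSpectrum (G : Subgroup SL(2, ℝ)) : Set ℝ :=
  {x | ∃ f : BinForm, 0 < f.disc ∧ 0 < minOn G f ∧ x = Real.sqrt f.disc / minOn G f}

/-- The upper limit of `√δ(f) / |f(M)|` over `M ∈ G`, as a number in `[0, ∞]`. Here `f(M)` depends
only on the vector `v = M (1, 0)ᵗ`, and the upper limit is taken over the distinct vectors `v`:
it is the infimum, over the finite sets `F` of vectors, of the supremum over the `v` outside `F`.
A quotient `√δ(f) / 0` is `∞`. -/
noncomputable def lagrangeNumber (G : Subgroup SL(2, ℝ)) (f : BinForm) : ℝ≥0∞ :=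
  Filter.limsup
    (fun v : cuspOrbit G => ENNReal.ofReal (Real.sqrt f.disc) / ENNReal.ofReal |f.eval v|)
    Filter.cofinite

/-- The form `f` has a real zero `u ≠ 0` that is not proportional to any vector `M (1, 0)ᵗ`,
`M ∈ G`: the geodesic of `f` does not join two cusps. -/
def HasNonCuspidalZero (G : Subgroup SL(2, ℝ)) (f : BinForm) : Prop :=
  ∃ u : Fin 2 → ℝ, u ≠ 0 ∧ f.eval u = 0 ∧ ∀ v ∈ cuspOrbit G, ∀ t : ℝ, u ≠ t • v

/-- The (finite part of the) Lagrange spectrum of `G`: the finite values of the upper limit of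
`√δ(f) / |f(M)|` over `M ∈ G`, for the forms with `δ(f) > 0`. The forms all of whose zeros are
cusps are left out, as rational numbers are in the classical Lagrange spectrum: the two ends of
the projected geodesic run into the cusp and have no upper limit of finite height. -/
def lagrangeSpectrum (G : Subgroup SL(2, ℝ)) : Set ℝ :=
  {x | 0 ≤ x ∧ ∃ f : BinForm, 0 < f.disc ∧ HasNonCuspidalZero G f ∧
    lagrangeNumber G f = ENNReal.ofReal x}

end HeckeSpectra

/-! Write A = (1, √2; 0, 1), B = (√2, 1; 1, √2), C = (1, 0; √2, 1). These elements of the group map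
(0, ∞) onto (√2, ∞), (1/√2, √2), (0, 1/√2), the intervals cut out by the ideal quadrilateral with
vertices ∞, √2, 1/√2, 0. A geodesic crossing its translates is therefore coded by a word in A, B, C.

Positive dimension comes from words B^j₀ A C B^j₁ A C ⋯. One more B lowers the coded number whatever
follows, so the smallest exponent dominates (`blockMap_le_of_lt`). Take the exponents N, N + 1 + d₀,
N + 1 + d₁, … with binary digits dᵢ. `markedSeq` repeats ever longer initial segments of this list,
each preceded by a marker exponent that tends to infinity. Just after a marker the backward number
tends to 1 and the forward number to the full expansion, so the heights there tend to `codeValue N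
d`. No other height exceeds this: vectors met by the geodesic are controlled by comparing exponents,
and all other orbit vectors by a descent through the tessellation (`IsAdmissible.valueBound`). Hence
`codeValue N d` is a Lagrange value (`lagrangeNumber_codeForm`).

As N grows the coded number tends to 1 and `codeValue N d` to `acMap 1 + 1`, which is 2√2. For fixed
N, digit sequences with different n-th digits and equal earlier ones give values at least c qⁿ apart
(`le_abs_codeValue_sub`), so reading off the digits is a Hölder map onto [0, 1] and the dimension is
positive (`dimH_range_pos_of_separated`).

For the comparison of the two spectra, reduced forms equivalent to f, taken along vectors that
realise the upper limit, converge to a form whose infimum is attained and gives the same number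
(`mem_markoffSpectrum_of_mem_lagrangeSpectrum`). -/

namespace HeckeSpectra

open Filter Topology

/-! ### The Möbius maps of the blocks B^j A C: monotonicity and separation -/

/-- The Möbius map of `A C`, where `A = (1, √2; 0, 1)` and `C = (1, 0; √2, 1)`. -/
noncomputable def acMap (x : ℝ) : ℝ := √2 + x / (√2 * x + 1)

/-- The hyperbolic map with fixed points `1` and `-1` and multiplier `c` at `1`. -/
noncomputable def beta (c x : ℝ) : ℝ := ((1 + c) * x + (1 - c)) / ((1 - c) * x + (1 + c))

/-- The multiplier at `1` of the Möbius map of `(√2, 1; 1, √2)`. -/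
noncomputable def betaRatio : ℝ := 3 - 2 * √2

/-- The Möbius map of the word `B ^ j * A * C`, where `B = (√2, 1; 1, √2)`. -/
noncomputable def blockMap (j : ℕ) (x : ℝ) : ℝ := beta (betaRatio ^ j) (acMap x)

lemma sqrt_two_mul_self : √2 * √2 = (2 : ℝ) := Real.mul_self_sqrt (by norm_num)

lemma sqrt_two_gt : (1.41 : ℝ) < √2 := Real.lt_sqrt_of_sq_lt (by norm_num)

lemma sqrt_two_lt : √2 < (1.42 : ℝ) := by
  rw [Real.sqrt_lt' (by norm_num)]; norm_num

lemma betaRatio_pos : 0 < betaRatio := by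
  have := sqrt_two_lt; unfold betaRatio; linarith

lemma betaRatio_lt_one : betaRatio < 1 := by
  have := sqrt_two_gt; unfold betaRatio; linarith

lemma betaRatio_pow_pos (j : ℕ) : 0 < betaRatio ^ j := pow_pos betaRatio_pos j

lemma betaRatio_pow_le_one (j : ℕ) : betaRatio ^ j ≤ 1 :=
  pow_le_one₀ betaRatio_pos.le betaRatio_lt_one.le

lemma sqrt_two_lt_acMap {x : ℝ} (hx : 0 < x) : √2 < acMap x := by
  have : 0 < x / (√2 * x + 1) := by positivity
  unfold acMap; linarith

lemma acMap_le_three {x : ℝ} (hx : 0 ≤ x) : acMap x ≤ 3 := by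
  have h1 := sqrt_two_gt
  have h2 := sqrt_two_lt
  have : x / (√2 * x + 1) ≤ 1 := by
    rw [div_le_one (by positivity)]; nlinarith
  unfold acMap; linarith

lemma acMap_sub {x y : ℝ} (hx : 0 ≤ x) (hy : 0 ≤ y) :
    acMap x - acMap y = (x - y) / ((√2 * x + 1) * (√2 * y + 1)) := by
  have h1 : √2 * x + 1 ≠ 0 := by positivity
  have h2 : √2 * y + 1 ≠ 0 := by positivity
  unfold acMap; field_simp; ring

lemma acMap_le_acMap {x y : ℝ} (hx : 0 ≤ x) (h : x ≤ y) : acMap x ≤ acMap y := by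
  have := acMap_sub (hx.trans h) hx
  have h3 : 0 ≤ (y - x) / ((√2 * y + 1) * (√2 * x + 1)) := by
    have : 0 ≤ y := hx.trans h
    have : 0 ≤ y - x := by linarith
    positivity
  linarith

lemma acMap_sub_le {x y : ℝ} (hx : 0 ≤ x) (h : x ≤ y) : acMap y - acMap x ≤ y - x := by
  rw [acMap_sub (hx.trans h) hx]
  have : 0 ≤ y := hx.trans h
  apply div_le_self (by linarith)
  have h1 : 1 ≤ √2 * y + 1 := by linarith [show 0 ≤ √2 * y by positivity]
  have h2 : 1 ≤ √2 * x + 1 := by linarith [show 0 ≤ √2 * x by positivity]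
  nlinarith

lemma acMap_one : acMap 1 = 2 * √2 - 1 := by
  have h : √2 + 1 ≠ 0 := by positivity
  have := sqrt_two_mul_self
  unfold acMap
  rw [mul_one]; field_simp; nlinarith

lemma beta_den_pos {c x : ℝ} (hc : 0 < c) (hc1 : c ≤ 1) (hx : 0 ≤ x) :
    0 < (1 - c) * x + (1 + c) := by
  have : 0 ≤ (1 - c) * x := mul_nonneg (by linarith) hx
  linarith

lemma beta_sub {c x y : ℝ} (hc : 0 < c) (hc1 : c ≤ 1) (hx : 0 ≤ x) (hy : 0 ≤ y) :
    beta c x - beta c y =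
      4 * c * (x - y) / (((1 - c) * x + (1 + c)) * ((1 - c) * y + (1 + c))) := by
  have h1 := (beta_den_pos hc hc1 hx).ne'
  have h2 := (beta_den_pos hc hc1 hy).ne'
  unfold beta; rw [div_sub_div _ _ h1 h2]; congr 1; ring

lemma beta_le_beta {c x y : ℝ} (hc : 0 < c) (hc1 : c ≤ 1) (hx : 0 ≤ x) (h : x ≤ y) :
    beta c x ≤ beta c y := by
  have hy := hx.trans h
  have := beta_sub hc hc1 hy hx
  have h1 := beta_den_pos hc hc1 hx
  have h2 := beta_den_pos hc hc1 hy
  have h3 : 0 ≤ 4 * c * (y - x) / (((1 - c) * y + (1 + c)) * ((1 - c) * x + (1 + c))) := by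
    have : 0 ≤ y - x := by linarith
    positivity
  linarith

lemma beta_apply_one (c : ℝ) : beta c 1 = 1 := by
  unfold beta
  rw [show (1 + c) * 1 + (1 - c) = 2 by ring, show (1 - c) * 1 + (1 + c) = 2 by ring]
  norm_num

lemma beta_one (x : ℝ) : beta 1 x = x := by
  unfold beta; norm_num

lemma one_le_beta {c x : ℝ} (hc : 0 < c) (hc1 : c ≤ 1) (hx : 1 ≤ x) : 1 ≤ beta c x :=
  (beta_apply_one c).symm.le.trans (beta_le_beta hc hc1 zero_le_one hx)

/-- In the coordinate (x - 1)/(x + 1) the map `beta c` is multiplication by c, so multipliers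
multiply. -/
lemma beta_beta {c d x : ℝ} (hd : 0 < d) (hd1 : d ≤ 1) (hx : 0 ≤ x) :
    beta c (beta d x) = beta (c * d) x := by
  have h1 := (beta_den_pos hd hd1 hx).ne'
  unfold beta
  rw [← mul_div_mul_right _ _ h1]
  rw [show (1 + c) * (((1 + d) * x + (1 - d)) / ((1 - d) * x + (1 + d))) + (1 - c) =
    2 * ((1 + c * d) * x + (1 - c * d)) / ((1 - d) * x + (1 + d)) by
      rw [mul_div_assoc', div_add' _ _ _ h1]; congr 1; ring]
  rw [show (1 - c) * (((1 + d) * x + (1 - d)) / ((1 - d) * x + (1 + d))) + (1 + c) =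
    2 * ((1 - c * d) * x + (1 + c * d)) / ((1 - d) * x + (1 + d)) by
      rw [mul_div_assoc', div_add' _ _ _ h1]; congr 1; ring]
  rw [div_mul_cancel₀ _ h1, div_mul_cancel₀ _ h1, mul_div_mul_left _ _ two_ne_zero]

lemma beta_le_self {c x : ℝ} (hc : 0 < c) (hc1 : c ≤ 1) (hx : 1 ≤ x) : beta c x ≤ x := by
  unfold beta
  rw [div_le_iff₀ (beta_den_pos hc hc1 (by linarith))]
  nlinarith [mul_nonneg (sub_nonneg.2 hc1) (mul_nonneg (sub_nonneg.2 hx) (by linarith : 0 ≤ x + 1))]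

lemma beta_betaRatio {x : ℝ} (hx : 0 < x) : beta betaRatio x = (√2 * x + 1) / (x + √2) := by
  have h := sqrt_two_mul_self
  have h1 := (beta_den_pos betaRatio_pos betaRatio_lt_one.le hx.le).ne'
  have h2 : x + √2 ≠ 0 := by positivity
  unfold beta
  rw [div_eq_div_iff h1 h2]
  unfold betaRatio
  linear_combination (-2 * x ^ 2 + 2) * h

lemma beta_betaRatio_le {x : ℝ} (hx : 0 < x) : beta betaRatio x ≤ √2 := by
  have h := sqrt_two_mul_self
  rw [beta_betaRatio hx, div_le_iff₀ (by positivity)]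
  linarith

lemma beta_betaRatio_pow_succ {x : ℝ} (i : ℕ) (hx : 0 ≤ x) :
    beta (betaRatio ^ (i + 1)) x = beta betaRatio (beta (betaRatio ^ i) x) := by
  rw [beta_beta (betaRatio_pow_pos i) (betaRatio_pow_le_one i) hx, pow_succ']

/-- The outermost factor is the map of B, which sends positive numbers below √2. -/
lemma beta_betaRatio_pow_le {x : ℝ} {i : ℕ} (hi : i ≠ 0) (hx : 1 ≤ x) :
    beta (betaRatio ^ i) x ≤ √2 := by
  obtain ⟨i, rfl⟩ := Nat.exists_eq_succ_of_ne_zero hi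
  rw [Nat.succ_eq_add_one, beta_betaRatio_pow_succ i (by linarith)]
  apply beta_betaRatio_le
  linarith [one_le_beta (betaRatio_pow_pos i) (betaRatio_pow_le_one i) hx]

lemma one_le_acMap {x : ℝ} (hx : 0 < x) : 1 ≤ acMap x := by
  linarith [sqrt_two_lt_acMap hx, sqrt_two_gt]

lemma one_le_blockMap (j : ℕ) {x : ℝ} (hx : 0 < x) : 1 ≤ blockMap j x :=
  one_le_beta (betaRatio_pow_pos j) (betaRatio_pow_le_one j) (one_le_acMap hx)

lemma blockMap_le_three (j : ℕ) {x : ℝ} (hx : 0 < x) : blockMap j x ≤ 3 :=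
  (beta_le_self (betaRatio_pow_pos j) (betaRatio_pow_le_one j) (one_le_acMap hx)).trans
    (acMap_le_three hx.le)

lemma blockMap_le_blockMap (j : ℕ) {x y : ℝ} (hx : 0 < x) (h : x ≤ y) :
    blockMap j x ≤ blockMap j y :=
  beta_le_beta (betaRatio_pow_pos j) (betaRatio_pow_le_one j)
    (by linarith [one_le_acMap hx]) (acMap_le_acMap hx.le h)

lemma blockMap_le_beta_sqrt_two {i j : ℕ} (hij : i < j) {x : ℝ} (hx : 0 < x) :
    blockMap j x ≤ beta (betaRatio ^ i) √2 := by
  obtain ⟨k, rfl⟩ := Nat.exists_eq_add_of_lt hij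
  have h1 := one_le_acMap hx
  unfold blockMap
  rw [add_assoc, pow_add, ← beta_beta (betaRatio_pow_pos _) (betaRatio_pow_le_one _) (by linarith)]
  exact beta_le_beta (betaRatio_pow_pos _) (betaRatio_pow_le_one _)
    (by linarith [one_le_beta (betaRatio_pow_pos (k + 1)) (betaRatio_pow_le_one (k + 1)) h1])
    (beta_betaRatio_pow_le k.succ_ne_zero h1)

/-- After cancelling the i common factors B, one side still begins with B and is at most √2, while
the other begins with A C and exceeds √2. The arguments x and y play no role, which makes the
expansion order reversing in its first exponent. -/
lemma blockMap_le_of_lt {i j : ℕ} (hij : i < j) {x y : ℝ} (hx : 0 < x) (hy : 0 < y) :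
    blockMap j x ≤ blockMap i y :=
  (blockMap_le_beta_sqrt_two hij hx).trans (beta_le_beta (betaRatio_pow_pos i)
    (betaRatio_pow_le_one i) (Real.sqrt_nonneg 2) (sqrt_two_lt_acMap hy).le)

lemma blockMap_sub_one_le (j : ℕ) {x : ℝ} (hx : 0 < x) :
    blockMap j x - 1 ≤ 4 * betaRatio ^ j := by
  have h1 := one_le_acMap hx
  have h3 := acMap_le_three hx.le
  have hc := betaRatio_pow_pos j
  have hc1 := betaRatio_pow_le_one j
  unfold blockMap
  set c := betaRatio ^ j
  set z := acMap x
  have h2 := beta_den_pos hc hc1 (by linarith : (0 : ℝ) ≤ z)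
  have h4 : 1 ≤ (1 - c) * z + (1 + c) := by nlinarith
  rw [show beta c z - 1 = 2 * c * (z - 1) / ((1 - c) * z + (1 + c)) by
    unfold beta; rw [div_sub_one h2.ne']; congr 1; ring]
  rw [div_le_iff₀ h2]
  have : 2 * c * (z - 1) ≤ 4 * c := by nlinarith
  nlinarith

lemma le_beta_sub {c x y : ℝ} (hc : 0 < c) (hc1 : c ≤ 1) (hx : 1 ≤ x) (hx3 : x ≤ 3)
    (hy : 1 ≤ y) (h : y ≤ x) : c / 4 * (x - y) ≤ beta c x - beta c y := by
  rw [beta_sub hc hc1 (by linarith) (by linarith)]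
  have h1 := beta_den_pos hc hc1 (by linarith : (0 : ℝ) ≤ x)
  have h2 := beta_den_pos hc hc1 (by linarith : (0 : ℝ) ≤ y)
  rw [le_div_iff₀ (by positivity)]
  have h3 : (1 - c) * x + (1 + c) ≤ 4 := by nlinarith
  have h4 : (1 - c) * y + (1 + c) ≤ 4 := by nlinarith
  have h5 : ((1 - c) * x + (1 + c)) * ((1 - c) * y + (1 + c)) ≤ 4 * 4 := by gcongr
  have h6 : 0 ≤ c / 4 * (x - y) := mul_nonneg (by positivity) (by linarith)
  nlinarith

lemma le_acMap_sub {x y : ℝ} (hx3 : x ≤ 3) (hy : 1 ≤ y) (h : y ≤ x) :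
    (x - y) / 36 ≤ acMap x - acMap y := by
  rw [acMap_sub (by linarith) (by linarith)]
  have h2 := sqrt_two_lt
  have hx : 0 < x := by linarith
  have hy0 : 0 < y := by linarith
  have h3 : √2 * x + 1 ≤ 6 := by nlinarith
  have h4 : √2 * y + 1 ≤ 6 := by nlinarith
  have h5 : (√2 * x + 1) * (√2 * y + 1) ≤ 6 * 6 := by gcongr
  apply div_le_div_of_nonneg_left (by linarith) (by positivity) (by linarith)

lemma le_blockMap_sub (j : ℕ) {x y : ℝ} (hx3 : x ≤ 3) (hy : 1 ≤ y) (h : y ≤ x) :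
    betaRatio ^ j / 144 * (x - y) ≤ blockMap j x - blockMap j y := by
  have hx : 0 < x := by linarith
  have hy0 : 0 < y := by linarith
  have h1 := le_beta_sub (betaRatio_pow_pos j) (betaRatio_pow_le_one j) (one_le_acMap hx)
    (acMap_le_three hx.le) (one_le_acMap hy0) (acMap_le_acMap hy0.le h)
  have h2 := le_acMap_sub hx3 hy h
  unfold blockMap
  refine le_trans ?_ h1
  have := mul_le_mul_of_nonneg_left h2 (by have := betaRatio_pow_pos j; positivity :
    0 ≤ betaRatio ^ j / 4)
  linarith

lemma le_abs_blockMap_sub (j : ℕ) {x y : ℝ} (hx1 : 1 ≤ x) (hx3 : x ≤ 3) (hy : 1 ≤ y)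
    (hy3 : y ≤ 3) : betaRatio ^ j / 144 * |x - y| ≤ |blockMap j x - blockMap j y| := by
  rcases le_total y x with h | h
  · rw [abs_of_nonneg (sub_nonneg.2 h)]
    exact (le_blockMap_sub j hx3 hy h).trans (le_abs_self _)
  · rw [abs_sub_comm, abs_sub_comm (blockMap j x), abs_of_nonneg (sub_nonneg.2 h)]
    exact (le_blockMap_sub j hy3 hx1 h).trans (le_abs_self _)

/-- A quantitative form of the separation by √2: `acMap x` exceeds √2 by at least 1/3 when x ≥ 1,
and the i common factors shrink this by at most `betaRatio ^ i / 4`. -/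
lemma le_blockMap_sub_of_lt {i j : ℕ} (hij : i < j) {x y : ℝ} (hx : 1 ≤ x) (hy : 0 < y) :
    betaRatio ^ i / 12 ≤ blockMap i x - blockMap j y := by
  have hx0 : 0 < x := by linarith
  have h1 := blockMap_le_beta_sqrt_two hij hy
  have h2 := le_beta_sub (betaRatio_pow_pos i) (betaRatio_pow_le_one i) (one_le_acMap hx0)
    (acMap_le_three hx0.le) (by linarith [sqrt_two_gt]) (sqrt_two_lt_acMap hx0).le
  have h3 : 1 / 3 ≤ acMap x - √2 := by
    unfold acMap
    rw [add_sub_cancel_left, le_div_iff₀ (by positivity)]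
    nlinarith [sqrt_two_lt]
  have h4 : blockMap i x = beta (betaRatio ^ i) (acMap x) := rfl
  have := mul_le_mul_of_nonneg_left h3 (by have := betaRatio_pow_pos i; positivity :
    0 ≤ betaRatio ^ i / 4)
  linarith

lemma continuousAt_blockMap (j : ℕ) {x : ℝ} (hx : 0 < x) : ContinuousAt (blockMap j) x := by
  have h1 : √2 * x + 1 ≠ 0 := by positivity
  have h2 := (beta_den_pos (betaRatio_pow_pos j) (betaRatio_pow_le_one j)
    (by linarith [one_le_acMap hx] : 0 ≤ acMap x)).ne'
  have h3 : ContinuousAt acMap x := by unfold acMap; fun_prop (disch := assumption)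
  unfold blockMap beta
  fun_prop (disch := assumption)

/-! ### Infinite expansions -/

/-- The finite composition `blockMap (j 0) (⋯ (blockMap (j (n - 1)) 1))`. -/
noncomputable def blockIter : ℕ → (ℕ → ℕ) → ℝ
  | 0, _ => 1
  | n + 1, j => blockMap (j 0) (blockIter n fun i => j (i + 1))

/-- The infinite composition of the maps `blockMap (j i)`. -/
noncomputable def blockLimit (j : ℕ → ℕ) : ℝ := ⨆ n, blockIter n j

lemma one_le_blockIter (n : ℕ) (j : ℕ → ℕ) : 1 ≤ blockIter n j := by
  induction n generalizing j with
  | zero => exact le_rfl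
  | succ n ih => exact one_le_blockMap _ (by linarith [ih fun i => j (i + 1)])

lemma blockIter_le_three (n : ℕ) (j : ℕ → ℕ) : blockIter n j ≤ 3 := by
  cases n with
  | zero => norm_num [blockIter]
  | succ n => exact blockMap_le_three _ (by linarith [one_le_blockIter n fun i => j (i + 1)])

lemma blockIter_le_succ (n : ℕ) (j : ℕ → ℕ) : blockIter n j ≤ blockIter (n + 1) j := by
  induction n generalizing j with
  | zero => exact one_le_blockIter 1 j
  | succ n ih =>
    exact blockMap_le_blockMap _ (by linarith [one_le_blockIter n fun i => j (i + 1)])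
      (ih fun i => j (i + 1))

lemma tendsto_blockIter (j : ℕ → ℕ) :
    Tendsto (fun n => blockIter n j) atTop (𝓝 (blockLimit j)) :=
  tendsto_atTop_ciSup (monotone_nat_of_le_succ fun n => blockIter_le_succ n j)
    ⟨3, by rintro _ ⟨n, rfl⟩; exact blockIter_le_three n j⟩

lemma blockIter_le_blockLimit (n : ℕ) (j : ℕ → ℕ) : blockIter n j ≤ blockLimit j :=
  le_ciSup (f := fun n => blockIter n j)
    ⟨3, by rintro _ ⟨n, rfl⟩; exact blockIter_le_three n j⟩ n

lemma one_le_blockLimit (j : ℕ → ℕ) : 1 ≤ blockLimit j := blockIter_le_blockLimit 0 j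

lemma blockLimit_le_three (j : ℕ → ℕ) : blockLimit j ≤ 3 :=
  ciSup_le fun n => blockIter_le_three n j

lemma blockLimit_eq (j : ℕ → ℕ) :
    blockLimit j = blockMap (j 0) (blockLimit fun i => j (i + 1)) := by
  have h1 := (tendsto_blockIter j).comp (tendsto_add_atTop_nat 1)
  have h2 := (continuousAt_blockMap (j 0) (by linarith [one_le_blockLimit fun i => j (i + 1)] :
    0 < blockLimit fun i => j (i + 1))).tendsto.comp (tendsto_blockIter fun i => j (i + 1))
  exact tendsto_nhds_unique h1 h2

lemma blockIter_congr {n : ℕ} {j k : ℕ → ℕ} (h : ∀ i < n, j i = k i) :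
    blockIter n j = blockIter n k := by
  induction n generalizing j k with
  | zero => rfl
  | succ n ih =>
    simp only [blockIter]
    rw [h 0 n.succ_pos, ih fun i hi => h (i + 1) (by omega)]

/-- Each common block shrinks distances on [1, 3] at most by the factor `betaRatio ^ N / 144`, and
the first differing block leaves a gap of at least `betaRatio ^ N / 12`. -/
lemma le_abs_blockLimit_sub {N : ℕ} (n : ℕ) {j k : ℕ → ℕ} (hj : ∀ i, j i ≤ N)
    (hk : ∀ i, k i ≤ N) (h : ∀ i < n, j i = k i) (hn : j n ≠ k n) :
    betaRatio ^ N / 12 * (betaRatio ^ N / 144) ^ n ≤ |blockLimit j - blockLimit k| := by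
  have hanti : ∀ {i : ℕ}, i ≤ N → betaRatio ^ N ≤ betaRatio ^ i := fun hi =>
    pow_le_pow_of_le_one betaRatio_pos.le betaRatio_lt_one.le hi
  induction n generalizing j k with
  | zero =>
    rw [pow_zero, mul_one, blockLimit_eq j, blockLimit_eq k]
    have h1 := one_le_blockLimit fun i => j (i + 1)
    have h2 := one_le_blockLimit fun i => k (i + 1)
    rcases lt_or_gt_of_ne hn with hlt | hlt
    · have := le_blockMap_sub_of_lt hlt h1 (by linarith : 0 < blockLimit fun i => k (i + 1))
      have h4 := hanti (hj 0)
      exact le_trans (by linarith) (this.trans (le_abs_self _))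
    · have := le_blockMap_sub_of_lt hlt h2 (by linarith : 0 < blockLimit fun i => j (i + 1))
      have h4 := hanti (hk 0)
      rw [abs_sub_comm]
      exact le_trans (by linarith) (this.trans (le_abs_self _))
  | succ n ih =>
    have h1 := ih (fun i => hj (i + 1)) (fun i => hk (i + 1)) (fun i hi => h (i + 1) (by omega)) hn
    rw [blockLimit_eq j, blockLimit_eq k, h 0 n.succ_pos]
    refine le_trans ?_ (le_abs_blockMap_sub (k 0) (one_le_blockLimit _) (blockLimit_le_three _)
      (one_le_blockLimit _) (blockLimit_le_three _))
    have h4 := hanti (hk 0)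
    have h5 := betaRatio_pow_pos N
    have h6 := betaRatio_pow_pos (k 0)
    calc betaRatio ^ N / 12 * (betaRatio ^ N / 144) ^ (n + 1)
        = betaRatio ^ N / 144 * (betaRatio ^ N / 12 * (betaRatio ^ N / 144) ^ n) := by ring
      _ ≤ _ := by gcongr

end HeckeSpectra

/-! ### The invariant lattice set, transformed forms, and finiteness -/

namespace HeckeSpectra

open Filter Topology

lemma heckeLambda_four : heckeLambda 4 = √2 := by
  unfold heckeLambda
  rw [show (Real.pi / ((4 : ℕ) : ℝ)) = Real.pi / 4 by norm_num, Real.cos_pi_div_four]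
  ring

/-- The vectors `(p, q √2)` and `(p √2, q)` with integers `p`, `q`. -/
def heckeLattice : Set (Fin 2 → ℝ) :=
  {v | ∃ p q : ℤ, (v 0 = p ∧ v 1 = q * √2) ∨ (v 0 = p * √2 ∧ v 1 = q)}

lemma mulVec_zero (M : SL(2, ℝ)) (v : Fin 2 → ℝ) :
    Matrix.mulVec (M : Matrix (Fin 2) (Fin 2) ℝ) v 0 = M 0 0 * v 0 + M 0 1 * v 1 := by
  simp [Matrix.mulVec, dotProduct, Fin.sum_univ_two]

lemma mulVec_one (M : SL(2, ℝ)) (v : Fin 2 → ℝ) :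
    Matrix.mulVec (M : Matrix (Fin 2) (Fin 2) ℝ) v 1 = M 1 0 * v 0 + M 1 1 * v 1 := by
  simp [Matrix.mulVec, dotProduct, Fin.sum_univ_two]

lemma mul_entry (M N : SL(2, ℝ)) (i j : Fin 2) :
    (M * N) i j = M i 0 * N 0 j + M i 1 * N 1 j := by
  rw [Matrix.SpecialLinearGroup.coe_mul, Matrix.mul_apply, Fin.sum_univ_two]

lemma det_eq_one (M : SL(2, ℝ)) : M 0 0 * M 1 1 - M 0 1 * M 1 0 = 1 := by
  have := M.det_coe
  rwa [Matrix.det_fin_two] at this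

lemma heckeS_mulVec_mem_iff (v : Fin 2 → ℝ) :
    Matrix.mulVec (heckeS : Matrix (Fin 2) (Fin 2) ℝ) v ∈ heckeLattice ↔ v ∈ heckeLattice := by
  simp only [heckeLattice, Set.mem_ofPred_eq, mulVec_zero, mulVec_one]
  simp only [heckeS, Matrix.of_apply, Matrix.cons_val', Matrix.cons_val_zero,
    Matrix.cons_val_fin_one, Matrix.cons_val_one, zero_mul, one_mul, zero_add, add_zero, neg_mul]
  constructor
  · rintro ⟨p, q, ⟨h1, h2⟩ | ⟨h1, h2⟩⟩
    · exact ⟨q, -p, Or.inr ⟨h2, by push_cast; linarith⟩⟩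
    · exact ⟨q, -p, Or.inl ⟨h2, by push_cast; linarith⟩⟩
  · rintro ⟨p, q, ⟨h1, h2⟩ | ⟨h1, h2⟩⟩
    · exact ⟨-q, p, Or.inr ⟨by push_cast; linarith, h1⟩⟩
    · exact ⟨-q, p, Or.inl ⟨by push_cast; linarith, h1⟩⟩

lemma add_sqrt_two_mem_iff (k : ℤ) {v w : Fin 2 → ℝ} (h0 : w 0 = v 0 + k * √2 * v 1)
    (h1 : w 1 = v 1) (hv : v ∈ heckeLattice) : w ∈ heckeLattice := by
  have hs := sqrt_two_mul_self
  obtain ⟨p, q, ⟨h2, h3⟩ | ⟨h2, h3⟩⟩ := hv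
  · refine ⟨p + 2 * k * q, q, Or.inl ⟨?_, by rw [h1, h3]⟩⟩
    rw [h0, h2, h3]; push_cast; linear_combination (k * q : ℝ) * hs
  · refine ⟨p + k * q, q, Or.inr ⟨?_, by rw [h1, h3]⟩⟩
    rw [h0, h2, h3]; push_cast; ring

lemma heckeT_mulVec_mem_iff (v : Fin 2 → ℝ) :
    Matrix.mulVec (heckeT 4 : Matrix (Fin 2) (Fin 2) ℝ) v ∈ heckeLattice ↔ v ∈ heckeLattice := by
  have h0 : Matrix.mulVec (heckeT 4 : Matrix (Fin 2) (Fin 2) ℝ) v 0 = v 0 + √2 * v 1 := by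
    rw [mulVec_zero]; simp [heckeT, heckeLambda_four]
  have h1 : Matrix.mulVec (heckeT 4 : Matrix (Fin 2) (Fin 2) ℝ) v 1 = v 1 := by
    rw [mulVec_one]; simp [heckeT]
  constructor
  · exact add_sqrt_two_mem_iff (-1) (by rw [h0, h1]; push_cast; ring) h1.symm
  · exact add_sqrt_two_mem_iff 1 (by rw [h0]; push_cast; ring) h1

lemma mulVec_mem_heckeLattice_iff {M : SL(2, ℝ)} (hM : M ∈ heckeGroup 4) (v : Fin 2 → ℝ) :
    Matrix.mulVec (M : Matrix (Fin 2) (Fin 2) ℝ) v ∈ heckeLattice ↔ v ∈ heckeLattice := by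
  induction hM using Subgroup.closure_induction generalizing v with
  | mem x hx =>
    rcases hx with rfl | rfl
    · exact heckeS_mulVec_mem_iff v
    · exact heckeT_mulVec_mem_iff v
  | one => simp
  | mul x y _ _ hx hy =>
    rw [Matrix.SpecialLinearGroup.coe_mul, ← Matrix.mulVec_mulVec, hx, hy]
  | inv x _ hx =>
    rw [← hx, Matrix.mulVec_mulVec, ← Matrix.SpecialLinearGroup.coe_mul, mul_inv_cancel]
    simp

lemma cuspOrbit_subset_heckeLattice : cuspOrbit (heckeGroup 4) ⊆ heckeLattice := by
  rintro _ ⟨M, hM, rfl⟩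
  rw [mulVec_mem_heckeLattice_iff hM]
  exact ⟨1, 0, Or.inl (by simp)⟩

lemma ne_zero_of_mem_cuspOrbit {G : Subgroup SL(2, ℝ)} {v : Fin 2 → ℝ} (hv : v ∈ cuspOrbit G) :
    v ≠ 0 := by
  obtain ⟨M, -, rfl⟩ := hv
  intro h
  have h0 := congrFun h 0
  have h1 := congrFun h 1
  rw [mulVec_zero] at h0
  rw [mulVec_one] at h1
  have := det_eq_one M
  simp at h0 h1
  rw [h0, h1] at this
  simp at this

lemma abs_int_le {p : ℤ} {R : ℝ} (h : |(p : ℝ)| ≤ R) : p ∈ Set.Icc (-⌈R⌉) ⌈R⌉ := by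
  have h1 := (abs_le.1 h)
  have h2 := Int.le_ceil R
  constructor
  · have : -(⌈R⌉ : ℝ) ≤ p := by linarith
    exact_mod_cast this
  · have : (p : ℝ) ≤ ⌈R⌉ := by linarith
    exact_mod_cast this

lemma abs_le_abs_mul_sqrt_two (x : ℝ) : |x| ≤ |x * √2| := by
  rw [abs_mul, abs_of_pos (by positivity : 0 < √2)]
  exact le_mul_of_one_le_right (abs_nonneg x) (by linarith [sqrt_two_gt])

lemma finite_heckeLattice_inter (R : ℝ) :
    {v ∈ heckeLattice | |v 0| ≤ R ∧ |v 1| ≤ R}.Finite := by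
  let I := Set.Icc (-⌈R⌉) ⌈R⌉
  have hI : (I ×ˢ I).Finite := (Set.finite_Icc _ _).prod (Set.finite_Icc _ _)
  refine ((hI.image fun z : ℤ × ℤ => (![(z.1 : ℝ), z.2 * √2] : Fin 2 → ℝ)).union
    (hI.image fun z : ℤ × ℤ => (![z.1 * √2, (z.2 : ℝ)] : Fin 2 → ℝ))).subset ?_
  rintro v ⟨⟨p, q, ⟨h0, h1⟩ | ⟨h0, h1⟩⟩, h2, h3⟩ <;> rw [h0] at h2 <;> rw [h1] at h3
  · refine Or.inl ⟨(p, q), ⟨abs_int_le h2, abs_int_le ((abs_le_abs_mul_sqrt_two _).trans h3)⟩, ?_⟩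
    ext i; fin_cases i <;> simp [h0, h1]
  · refine Or.inr ⟨(p, q), ⟨abs_int_le ((abs_le_abs_mul_sqrt_two _).trans h2), abs_int_le h3⟩, ?_⟩
    ext i; fin_cases i <;> simp [h0, h1]

/-- The form `v ↦ f(M v)`. -/
noncomputable def BinForm.comp (f : BinForm) (M : SL(2, ℝ)) : BinForm where
  a := f.a * M 0 0 ^ 2 + f.b * (M 0 0 * M 1 0) + f.c * M 1 0 ^ 2
  b := 2 * f.a * (M 0 0 * M 0 1) + f.b * (M 0 0 * M 1 1 + M 0 1 * M 1 0)
    + 2 * f.c * (M 1 0 * M 1 1)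
  c := f.a * M 0 1 ^ 2 + f.b * (M 0 1 * M 1 1) + f.c * M 1 1 ^ 2

lemma BinForm.eval_comp (f : BinForm) (M : SL(2, ℝ)) (v : Fin 2 → ℝ) :
    (f.comp M).eval v = f.eval (Matrix.mulVec (M : Matrix (Fin 2) (Fin 2) ℝ) v) := by
  simp only [BinForm.eval, mulVec_zero, mulVec_one, BinForm.comp]
  ring

lemma BinForm.comp_a (f : BinForm) (M : SL(2, ℝ)) :
    (f.comp M).a = f.eval (Matrix.mulVec (M : Matrix (Fin 2) (Fin 2) ℝ) ![1, 0]) := by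
  rw [← BinForm.eval_comp]; simp [BinForm.eval]

lemma BinForm.disc_comp (f : BinForm) (M : SL(2, ℝ)) : (f.comp M).disc = f.disc := by
  have h := det_eq_one M
  have : (f.comp M).disc = f.disc * (M 0 0 * M 1 1 - M 0 1 * M 1 0) ^ 2 := by
    simp only [BinForm.disc, BinForm.comp]; ring
  rw [this, h]; ring

/-- The translation matrix `(1, t; 0, 1)`. -/
def translation (t : ℝ) : SL(2, ℝ) := ⟨!![1, t; 0, 1], by simp [Matrix.det_fin_two]⟩

lemma translation_add (s t : ℝ) : translation (s + t) = translation s * translation t := by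
  ext i j
  rw [mul_entry]
  fin_cases i <;> fin_cases j <;> simp [translation, add_comm]

lemma translation_zero : translation 0 = 1 := by
  ext i j
  fin_cases i <;> fin_cases j <;> simp [translation]

lemma heckeT_four : heckeT 4 = translation √2 := by
  ext i j
  fin_cases i <;> fin_cases j <;> simp [translation, heckeT, heckeLambda_four]

lemma translation_sqrt_two_mem : translation √2 ∈ heckeGroup 4 :=
  heckeT_four ▸ Subgroup.subset_closure (by simp)

lemma translation_mem (k : ℤ) : translation (k * √2) ∈ heckeGroup 4 := by
  induction k using Int.induction_on with
  | zero => simp [translation_zero, one_mem]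
  | succ k ih =>
    rw [show (((k : ℤ) + 1 : ℤ) : ℝ) * √2 = (k : ℤ) * √2 + √2 by push_cast; ring, translation_add]
    exact mul_mem ih translation_sqrt_two_mem
  | pred k ih =>
    have h : translation (-√2) = (translation √2)⁻¹ := by
      rw [eq_inv_iff_mul_eq_one, ← translation_add, neg_add_cancel, translation_zero]
    rw [show ((-(k : ℤ) - 1 : ℤ) : ℝ) * √2 = (-(k : ℤ) : ℤ) * √2 + -√2 by push_cast; ring,
      translation_add, h]
    exact mul_mem ih (inv_mem translation_sqrt_two_mem)

/-- Right multiplication by a translation keeps the first column, hence the leading coefficient a,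
and shifts the middle coefficient by multiples of 2√2 a. -/
lemma exists_reduced_comp (f : BinForm) {v : Fin 2 → ℝ} (hv : v ∈ cuspOrbit (heckeGroup 4))
    (h : f.eval v ≠ 0) : ∃ M ∈ heckeGroup 4,
      v = Matrix.mulVec (M : Matrix (Fin 2) (Fin 2) ℝ) ![1, 0] ∧
      |(f.comp M).b| ≤ √2 * |f.eval v| := by
  obtain ⟨M, hM, rfl⟩ := hv
  rw [← BinForm.comp_a] at h ⊢
  set g := f.comp M with hg
  let k := round (g.b / (2 * √2 * g.a))
  have hcol : Matrix.mulVec ((M * translation ((-k : ℤ) * √2) : SL(2, ℝ)) :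
      Matrix (Fin 2) (Fin 2) ℝ) ![1, 0] = Matrix.mulVec (M : Matrix (Fin 2) (Fin 2) ℝ) ![1, 0] := by
    rw [Matrix.SpecialLinearGroup.coe_mul, ← Matrix.mulVec_mulVec]
    congr 1
    ext i; fin_cases i <;> simp [translation]
  refine ⟨M * translation ((-k : ℤ) * √2), mul_mem hM (translation_mem _), hcol.symm, ?_⟩
  have hb : (f.comp (M * translation ((-k : ℤ) * √2))).b =
      (g.b / (2 * √2 * g.a) - k) * (2 * √2 * g.a) := by
    rw [sub_mul, div_mul_cancel₀ _ (by positivity)]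
    simp only [BinForm.comp, hg, mul_entry]
    simp [translation]
    ring
  rw [hb, abs_mul]
  have h1 := abs_sub_round (g.b / (2 * √2 * g.a))
  have h2 : |2 * √2 * g.a| = 2 * (√2 * |g.a|) := by
    rw [abs_mul, abs_of_pos (by positivity : 0 < 2 * √2)]; ring
  rw [h2]
  have h3 : 0 ≤ √2 * |g.a| := by positivity
  nlinarith

/-- The determinant condition puts v on a line parallel to w. There f is a polynomial of degree at
most 2 whose discriminant `f.disc * q ^ 2` is positive, so it is not constant and is bounded only on
a bounded piece, which has finitely many lattice points. -/
lemma finite_lattice_of_det_of_abs_eval_le (f : BinForm) (hf : 0 < f.disc) (w : Fin 2 → ℝ)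
    {q : ℝ} (hq : q ≠ 0) (R : ℝ) :
    {v ∈ heckeLattice | v 0 * w 1 - v 1 * w 0 = q ∧ |f.eval v| ≤ R}.Finite := by
  rcases Set.eq_empty_or_nonempty
    {v ∈ heckeLattice | v 0 * w 1 - v 1 * w 0 = q ∧ |f.eval v| ≤ R} with h | ⟨u, -, hu1, hu2⟩
  · rw [h]; exact Set.finite_empty
  set β := 2 * f.a * (u 0 * w 0) + f.b * (u 0 * w 1 + u 1 * w 0) + 2 * f.c * (u 1 * w 1) with hβ
  set α := f.eval w with hα
  have hdisc : β ^ 2 - 4 * α * f.eval u = f.disc * q ^ 2 := by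
    rw [hα, hβ, ← hu1]; unfold BinForm.eval BinForm.disc; ring
  have hw : 0 < w 0 ^ 2 + w 1 ^ 2 := by
    by_contra hcon
    have h0 : w 0 = 0 := by nlinarith [sq_nonneg (w 0), sq_nonneg (w 1)]
    have h1 : w 1 = 0 := by nlinarith [sq_nonneg (w 0), sq_nonneg (w 1)]
    rw [h0, h1] at hu1
    exact hq (by linarith)
  obtain ⟨K, hK⟩ : ∃ K : ℝ, ∀ t : ℝ, |f.eval u + t * β + t ^ 2 * α| ≤ R → |t| ≤ K := by
    have hle : ∀ t : ℝ, |f.eval u + t * β + t ^ 2 * α| ≤ R → |t * β + t ^ 2 * α| ≤ 2 * R := by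
      intro t ht
      have h1 := abs_le.1 ht
      have h2 := abs_le.1 hu2
      rw [abs_le]; constructor <;> linarith
    by_cases hα0 : α = 0
    · have hβ0 : 0 < |β| := by
        rw [abs_pos]; rintro h0
        rw [h0, hα0] at hdisc
        have : 0 < f.disc * q ^ 2 := by positivity
        linarith
      refine ⟨2 * R / |β|, fun t ht => ?_⟩
      have := hle t ht
      rw [hα0, mul_zero, add_zero, abs_mul] at this
      rwa [le_div_iff₀ hβ0]
    · have hα1 : 0 < |α| := abs_pos.2 hα0
      refine ⟨1 + (2 * R + |β|) / |α|, fun t ht => ?_⟩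
      have h1 := hle t ht
      have hR : 0 ≤ R := (abs_nonneg _).trans hu2
      have h0 : 0 ≤ (2 * R + |β|) / |α| := by positivity
      by_cases ht1 : |t| ≤ 1
      · linarith
      push Not at ht1
      have h2 : |t| ^ 2 * |α| ≤ 2 * R + |t| * |β| := by
        have := abs_sub_abs_le_abs_sub (t ^ 2 * α) (-(t * β))
        rw [abs_neg, abs_mul, abs_mul, abs_pow, sub_neg_eq_add, add_comm (t ^ 2 * α)] at this
        linarith
      have h3 : |t| ≤ (2 * R + |β|) / |α| := by
        rw [le_div_iff₀ hα1]
        have h4 : |t| * (|t| * |α|) ≤ |t| * (2 * R + |β|) := by nlinarith [abs_nonneg β]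
        exact le_of_mul_le_mul_left h4 (by linarith)
      linarith
  refine (finite_heckeLattice_inter
    (max (|u 0| + K * |w 0|) (|u 1| + K * |w 1|))).subset ?_
  rintro v ⟨hv, hv1, hv2⟩
  -- The parameter of v on the line u + t w, recovered by projecting v - u onto w.
  set t := ((v 0 - u 0) * w 0 + (v 1 - u 1) * w 1) / (w 0 ^ 2 + w 1 ^ 2) with ht
  have h0 : v 0 = u 0 + t * w 0 := by
    rw [ht]; field_simp
    linear_combination w 1 * hv1 - w 1 * hu1
  have h1 : v 1 = u 1 + t * w 1 := by
    rw [ht]; field_simp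
    linear_combination -w 0 * hv1 + w 0 * hu1
  have hte : f.eval v = f.eval u + t * β + t ^ 2 * α := by
    rw [hα, hβ]; unfold BinForm.eval; rw [h0, h1]; ring
  rw [hte] at hv2
  have htK := hK t hv2
  refine ⟨hv, le_max_of_le_left ?_, le_max_of_le_right ?_⟩
  · rw [h0]; refine (abs_add_le _ _).trans ?_
    rw [abs_mul]; gcongr
  · rw [h1]; refine (abs_add_le _ _).trans ?_
    rw [abs_mul]; gcongr

end HeckeSpectra

/-! ### Positive Lagrange values are Markoff values -/

namespace HeckeSpectra

open Filter Topology

lemma exists_tendsto_of_eventually_abs_le {α : Type*} (U : Ultrafilter α) {a : α → ℝ} {R : ℝ}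
    (h : ∀ᶠ v in U, |a v| ≤ R) : ∃ y, Tendsto a U (𝓝 y) := by
  obtain ⟨y, -, hy⟩ := (isCompact_Icc (a := -R) (b := R)).ultrafilter_le_nhds (U.map a)
    (le_principal_iff.2 (h.mono fun v hv => abs_le.1 hv : ∀ᶠ v in U, a v ∈ Set.Icc (-R) R))
  exact ⟨y, hy⟩

lemma lt_abs_eval_of_div_lt {D y η : ℝ} (hD : 0 < D) (hη : 0 < η)
    (h : ENNReal.ofReal D / ENNReal.ofReal |y| < ENNReal.ofReal η) : D / η < |y| := by
  by_cases hy : y = 0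
  · rw [hy, abs_zero, ENNReal.ofReal_zero, ENNReal.div_zero (by simpa using hD)] at h
    exact absurd h not_top_lt
  · have hy' : 0 < |y| := abs_pos.2 hy
    rw [← ENNReal.ofReal_div_of_pos hy', ENNReal.ofReal_lt_ofReal_iff hη] at h
    rw [div_lt_iff₀ hy'] at h
    rw [div_lt_iff₀ hη]; linarith

lemma tendsto_abs_of_tendsto_div {α : Type*} {l : Filter α} {y : α → ℝ} {D x : ℝ} (hD : 0 < D)
    (hx : 0 < x)
    (h : Tendsto (fun v => ENNReal.ofReal D / ENNReal.ofReal |y v|) l (𝓝 (ENNReal.ofReal x))) :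
    Tendsto (fun v => |y v|) l (𝓝 (D / x)) := by
  have h1 := (continuous_inv.tendsto (ENNReal.ofReal x)).comp h
  have h2 := ((ENNReal.tendsto_toReal (ENNReal.inv_ne_top.2 (by simpa using hx))).comp
    h1).const_mul D
  have hD' : ENNReal.ofReal D ≠ 0 := by simpa using hD
  convert! h2 using 2
  · simp only [Function.comp_apply]
    rw [ENNReal.inv_div (Or.inl ENNReal.ofReal_ne_top) (Or.inr hD'), ENNReal.toReal_div,
      ENNReal.toReal_ofReal (abs_nonneg _), ENNReal.toReal_ofReal hD.le]
    field_simp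
  · rw [ENNReal.toReal_inv, ENNReal.toReal_ofReal hx.le, div_eq_mul_inv]

lemma mul_mulVec_mem_cuspOrbit {G : Subgroup SL(2, ℝ)} {M N : SL(2, ℝ)} (hM : M ∈ G)
    (hN : N ∈ G) : Matrix.mulVec ((M * N : SL(2, ℝ)) : Matrix (Fin 2) (Fin 2) ℝ) ![1, 0] ∈
      cuspOrbit G := ⟨M * N, mul_mem hM hN, rfl⟩

/-- Otherwise one vector w would occur for an ultrafilter-large set of v. If M fixes the direction
of (1, 0), then w determines v. If not, v has fixed nonzero determinant with w and f(v) is bounded,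
so v ranges over a finite set. Both contradict U being finer than the cofinite filter. -/
lemma eventually_notMem_of_bounded_eval {f : BinForm} (hf : 0 < f.disc)
    (U : Ultrafilter (cuspOrbit (heckeGroup 4))) (hU : (U : Filter (cuspOrbit (heckeGroup 4))) ≤ cofinite) {R : ℝ}
    (hR : ∀ᶠ v : cuspOrbit (heckeGroup 4) in U, |f.eval v| ≤ R)
    {Mv : cuspOrbit (heckeGroup 4) → SL(2, ℝ)}
    (hMv : ∀ v : cuspOrbit (heckeGroup 4), (v : Fin 2 → ℝ) =
      Matrix.mulVec (Mv v : Matrix (Fin 2) (Fin 2) ℝ) ![1, 0])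
    (M : SL(2, ℝ)) {F : Set (Fin 2 → ℝ)} (hF : F.Finite) :
    ∀ᶠ v in U, Matrix.mulVec ((Mv v * M : SL(2, ℝ)) : Matrix (Fin 2) (Fin 2) ℝ) ![1, 0] ∉ F := by
  by_contra hnot
  have hcon := Ultrafilter.eventually_not.2 hnot
  have hmem : (⋃ w ∈ F, {v | Matrix.mulVec ((Mv v * M : SL(2, ℝ)) :
      Matrix (Fin 2) (Fin 2) ℝ) ![1, 0] = w}) ∈ U := by
    filter_upwards [hcon] with v hv
    simpa using hv
  obtain ⟨w, -, hw⟩ := (Ultrafilter.finite_biUnion_mem_iff hF).1 hmem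
  have hw' : ∀ᶠ v in U, Matrix.mulVec ((Mv v * M : SL(2, ℝ)) :
      Matrix (Fin 2) (Fin 2) ℝ) ![1, 0] = w := hw
  suffices hfin : ∃ s : Set (Fin 2 → ℝ), s.Finite ∧
      ∀ᶠ v : cuspOrbit (heckeGroup 4) in U, (v : Fin 2 → ℝ) ∈ s by
    obtain ⟨s, hs, hsU⟩ := hfin
    have h1 : (Subtype.val ⁻¹' s : Set (cuspOrbit (heckeGroup 4))).Finite :=
      hs.preimage Subtype.val_injective.injOn
    have h2 : ∀ᶠ v in U, v ∉ (Subtype.val ⁻¹' s : Set (cuspOrbit (heckeGroup 4))) :=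
      hU h1.compl_mem_cofinite
    obtain ⟨v, hv1, hv2⟩ := (hsU.and h2).exists
    exact hv2 hv1
  have hvec : ∀ v : cuspOrbit (heckeGroup 4), Matrix.mulVec ((Mv v * M : SL(2, ℝ)) :
      Matrix (Fin 2) (Fin 2) ℝ) ![1, 0] = w →
      (Mv v 0 0 * M 0 0 + Mv v 0 1 * M 1 0 = w 0 ∧ Mv v 1 0 * M 0 0 + Mv v 1 1 * M 1 0 = w 1) ∧
      (v : Fin 2 → ℝ) 0 = Mv v 0 0 ∧ (v : Fin 2 → ℝ) 1 = Mv v 1 0 := by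
    intro v hv
    have h0 := congrFun hv 0
    have h1 := congrFun hv 1
    have h2 := congrFun (hMv v) 0
    have h3 := congrFun (hMv v) 1
    rw [mulVec_zero, mul_entry] at h0
    rw [mulVec_one, mul_entry] at h1
    rw [mulVec_zero] at h2
    rw [mulVec_one] at h3
    simp only [Matrix.cons_val_zero, Matrix.cons_val_one, Matrix.cons_val_fin_one, mul_one,
      mul_zero, add_zero] at h0 h1 h2 h3
    exact ⟨⟨h0, h1⟩, h2, h3⟩
  by_cases hm : M 1 0 = 0
  · have hm0 : M 0 0 ≠ 0 := by
      intro h0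
      have := det_eq_one M
      rw [hm, h0] at this
      simp at this
    refine ⟨{![w 0 / M 0 0, w 1 / M 0 0]}, Set.finite_singleton _, ?_⟩
    filter_upwards [hw'] with v hv
    obtain ⟨⟨h0, h1⟩, h2, h3⟩ := hvec v hv
    rw [hm, mul_zero, add_zero] at h0 h1
    rw [Set.mem_singleton_iff]
    ext i
    fin_cases i
    · simp [h2, ← h0, hm0]
    · simp [h3, ← h1, hm0]
  -- The determinant of v and w is `M 1 0`, because `Mv v` has determinant 1 and first column v.
  · refine ⟨_, finite_lattice_of_det_of_abs_eval_le f hf w hm R, ?_⟩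
    filter_upwards [hw', hR] with v hv hvR
    obtain ⟨⟨h0, h1⟩, h2, h3⟩ := hvec v hv
    refine ⟨cuspOrbit_subset_heckeLattice v.2, ?_, hvR⟩
    rw [h2, h3, ← h0, ← h1]
    linear_combination M 1 0 * det_eq_one (Mv v)

theorem mem_markoffSpectrum_of_mem_lagrangeSpectrum {x : ℝ} (hx : 0 < x)
    (h : x ∈ lagrangeSpectrum (heckeGroup 4)) : x ∈ markoffSpectrum (heckeGroup 4) := by
  obtain ⟨-, f, hf, -, hlim⟩ := h
  set D := √f.disc with hDdef
  have hD : 0 < D := Real.sqrt_pos.2 hf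
  have hDx : 0 < D / x := div_pos hD hx
  unfold lagrangeNumber at hlim
  have : (cofinite : Filter (cuspOrbit (heckeGroup 4))).NeBot := by
    rw [neBot_iff]
    intro h0
    rw [h0, limsup_bot] at hlim
    have : 0 < ENNReal.ofReal x := by simpa using hx
    rw [← hlim] at this
    exact absurd this (by simp)
  have hcl := MapClusterPt.limsup (f := (cofinite : Filter (cuspOrbit (heckeGroup 4))))
    (u := fun v : cuspOrbit (heckeGroup 4) => ENNReal.ofReal D / ENNReal.ofReal |f.eval v|)
  rw [hlim] at hcl
  -- The upper limit is a cluster value, so it is an honest limit along some ultrafilter.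
  obtain ⟨U, hU, hUx⟩ := mapClusterPt_iff_ultrafilter.1 hcl
  have habs := tendsto_abs_of_tendsto_div hD hx hUx
  have hpos : ∀ᶠ v : cuspOrbit (heckeGroup 4) in U, f.eval v ≠ 0 := by
    filter_upwards [habs.eventually (lt_mem_nhds hDx)] with v hv using abs_pos.1 hv
  have hbd : ∀ᶠ v : cuspOrbit (heckeGroup 4) in U, |f.eval v| ≤ D / x + 1 := by
    filter_upwards [habs.eventually (gt_mem_nhds (lt_add_one (D / x)))] with v hv using hv.le
  have hch : ∀ v : cuspOrbit (heckeGroup 4), ∃ M ∈ heckeGroup 4,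
      (v : Fin 2 → ℝ) = Matrix.mulVec (M : Matrix (Fin 2) (Fin 2) ℝ) ![1, 0] ∧
      (f.eval v ≠ 0 → |(f.comp M).b| ≤ √2 * |f.eval v|) := by
    intro v
    by_cases h0 : f.eval v = 0
    · obtain ⟨M, hM, hv⟩ := v.2
      exact ⟨M, hM, hv, fun h => absurd h0 h⟩
    · obtain ⟨M, hM, hv, hb⟩ := exists_reduced_comp f v.2 h0
      exact ⟨M, hM, hv, fun _ => hb⟩
  choose Mv hMvG hMv hMvb using hch
  have hcompa : ∀ v, (f.comp (Mv v)).a = f.eval v := fun v => by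
    rw [BinForm.comp_a, ← hMv v]
  obtain ⟨a0, ha0⟩ := exists_tendsto_of_eventually_abs_le U hbd
  obtain ⟨b0, hb0⟩ : ∃ y, Tendsto (fun v => (f.comp (Mv v)).b) U (𝓝 y) := by
    refine exists_tendsto_of_eventually_abs_le U (R := √2 * (D / x + 1)) ?_
    filter_upwards [hpos, hbd] with v h1 h2
    exact (hMvb v h1).trans (by gcongr)
  have ha0abs : |a0| = D / x := tendsto_nhds_unique ha0.abs habs
  have ha0ne : a0 ≠ 0 := abs_pos.1 (ha0abs ▸ hDx)
  -- The last coefficient is forced by the constant discriminant, so only the first two need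
  -- compactness.
  let g : BinForm := ⟨a0, b0, (b0 ^ 2 - f.disc) / (4 * a0)⟩
  have hgdisc : g.disc = f.disc := by
    simp only [g, BinForm.disc]; field_simp; ring
  have hc0 : Tendsto (fun v => (f.comp (Mv v)).c) U (𝓝 g.c) := by
    have : Tendsto (fun v => ((f.comp (Mv v)).b ^ 2 - f.disc) / (4 * f.eval v)) U (𝓝 g.c) :=
      ((hb0.pow 2).sub_const _).div (ha0.const_mul 4) (by simpa using ha0ne)
    refine this.congr' ?_
    filter_upwards [hpos] with v hv
    have h1 := BinForm.disc_comp f (Mv v)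
    rw [div_eq_iff (by simpa using hv), ← hcompa v, ← h1]
    unfold BinForm.disc; ring
  have heval : ∀ m : Fin 2 → ℝ, Tendsto (fun v => (f.comp (Mv v)).eval m) U (𝓝 (g.eval m)) := by
    intro m
    simp only [BinForm.eval, hcompa]
    exact ((ha0.mul_const _).add (hb0.mul_const _)).add (hc0.mul_const _)
  have hlower : ∀ M : heckeGroup 4, D / x ≤ |g.eval (Matrix.mulVec ((M : SL(2, ℝ)) :
      Matrix (Fin 2) (Fin 2) ℝ) ![1, 0])| := by
    -- For fixed M the vectors `Mv v * M` applied to (1, 0) eventually leave the finite set where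
    -- the quotient is at least η; passing to the limit in v, and then letting η decrease to x,
    -- gives the bound.
    rintro ⟨M, hM⟩
    have key : ∀ η, x < η → D / η ≤ |g.eval (Matrix.mulVec (M :
        Matrix (Fin 2) (Fin 2) ℝ) ![1, 0])| := by
      intro η hη
      have hη0 : 0 < η := hx.trans hη
      have hev : ∀ᶠ v : cuspOrbit (heckeGroup 4) in cofinite,
          ENNReal.ofReal D / ENNReal.ofReal |f.eval v| < ENNReal.ofReal η := by
        refine eventually_lt_of_limsup_lt ?_ (by isBoundedDefault)
        rw [hlim]
        exact (ENNReal.ofReal_lt_ofReal_iff hη0).2 hη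
      rw [eventually_cofinite] at hev
      have hnot := eventually_notMem_of_bounded_eval hf U hU hbd hMv M (hev.image Subtype.val)
      refine ge_of_tendsto (heval _).abs ?_
      filter_upwards [hnot] with v hv
      rw [BinForm.eval_comp, Matrix.mulVec_mulVec, ← Matrix.SpecialLinearGroup.coe_mul]
      have hmem := mul_mulVec_mem_cuspOrbit (hMvG v) hM
      have : ENNReal.ofReal D / ENNReal.ofReal |f.eval (Matrix.mulVec ((Mv v * M : SL(2, ℝ)) :
          Matrix (Fin 2) (Fin 2) ℝ) ![1, 0])| < ENNReal.ofReal η := by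
        by_contra hcon
        exact hv ⟨⟨_, hmem⟩, hcon, rfl⟩
      exact (lt_abs_eval_of_div_lt hD hη0 this).le
    have hT : Tendsto (fun η => D / η) (𝓝[>] x) (𝓝 (D / x)) :=
      ((continuousAt_const.div continuousAt_id hx.ne').tendsto).mono_left nhdsWithin_le_nhds
    refine le_of_tendsto hT ?_
    filter_upwards [self_mem_nhdsWithin] with η hη using key η hη
  have hmin : minOn (heckeGroup 4) g = D / x := by
    apply le_antisymm
    · have h1 : minOn (heckeGroup 4) g ≤ |g.eval (Matrix.mulVec (((1 : heckeGroup 4) : SL(2, ℝ)) :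
          Matrix (Fin 2) (Fin 2) ℝ) ![1, 0])| :=
        ciInf_le ⟨0, by rintro _ ⟨M, rfl⟩; exact abs_nonneg _⟩ (1 : heckeGroup 4)
      refine h1.trans_eq ?_
      rw [← ha0abs]
      simp [BinForm.eval, g]
    · exact le_ciInf hlower
  refine ⟨g, hgdisc ▸ hf, hmin ▸ hDx, ?_⟩
  rw [hmin, hgdisc, ← hDdef]
  field_simp

/-- Only the value 0 escapes the inclusion, and a single point has dimension 0. -/
theorem dimH_lagrangeSpectrum_inter_le (s : Set ℝ) (hs : s ⊆ Set.Ici 0) :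
    dimH (lagrangeSpectrum (heckeGroup 4) ∩ s) ≤ dimH (markoffSpectrum (heckeGroup 4) ∩ s) := by
  have hsub : lagrangeSpectrum (heckeGroup 4) ∩ s ⊆
      (markoffSpectrum (heckeGroup 4) ∩ s) ∪ {0} := by
    rintro x ⟨hx, hxs⟩
    rcases (Set.mem_Ici.1 (hs hxs)).eq_or_lt with h | h
    · exact Or.inr h.symm
    · exact Or.inl ⟨mem_markoffSpectrum_of_mem_lagrangeSpectrum h hx, hxs⟩
  refine (dimH_mono hsub).trans ?_
  rw [dimH_union, dimH_singleton]
  simp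

end HeckeSpectra

/-! ### Descent through the tessellation -/

namespace HeckeSpectra

open Filter Topology

/-- The value at `(x, y)` of the form with roots `ξ` and `-a` is at least `√δ / l` in absolute
value. -/
def ValueBound (l ξ a x y : ℝ) : Prop := ξ + a ≤ l * |(x - ξ * y) * (x + a * y)|

/-- `x` and `y` are the coordinates of a vector in `heckeLattice`. -/
def IsLatticePair (x y : ℝ) : Prop :=
  ∃ p q : ℤ, (x = p ∧ y = q * √2) ∨ (x = p * √2 ∧ y = q)

lemma IsLatticePair.swap {x y : ℝ} (h : IsLatticePair x y) : IsLatticePair y x := by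
  obtain ⟨p, q, ⟨h1, h2⟩ | ⟨h1, h2⟩⟩ := h
  · exact ⟨q, p, Or.inr ⟨h2, h1⟩⟩
  · exact ⟨q, p, Or.inl ⟨h2, h1⟩⟩

lemma IsLatticePair.neg_left {x y : ℝ} (h : IsLatticePair x y) : IsLatticePair (-x) y := by
  obtain ⟨p, q, ⟨rfl, h2⟩ | ⟨rfl, h2⟩⟩ := h
  · exact ⟨-p, q, Or.inl ⟨by push_cast; ring, h2⟩⟩
  · exact ⟨-p, q, Or.inr ⟨by push_cast; ring, h2⟩⟩

lemma IsLatticePair.sub_sqrt_two_mul {x y : ℝ} (h : IsLatticePair x y) :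
    IsLatticePair (x - √2 * y) y := by
  have hs := sqrt_two_mul_self
  obtain ⟨p, q, ⟨rfl, rfl⟩ | ⟨rfl, rfl⟩⟩ := h
  · exact ⟨p - 2 * q, q, Or.inl ⟨by push_cast; linear_combination (-q : ℝ) * hs, rfl⟩⟩
  · exact ⟨p - q, q, Or.inr ⟨by push_cast; ring, rfl⟩⟩

lemma IsLatticePair.rotate {x y : ℝ} (h : IsLatticePair x y) :
    IsLatticePair (√2 * x - y) (√2 * y - x) := by
  have hs := sqrt_two_mul_self
  obtain ⟨p, q, ⟨rfl, rfl⟩ | ⟨rfl, rfl⟩⟩ := h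
  · exact ⟨p - q, 2 * q - p, Or.inr ⟨by push_cast; ring, by
      push_cast; linear_combination (q : ℝ) * hs⟩⟩
  · exact ⟨2 * p - q, q - p, Or.inl ⟨by push_cast; linear_combination (p : ℝ) * hs, by
      push_cast; ring⟩⟩

lemma one_le_of_pos_int {p : ℤ} (hp : 0 < (p : ℝ)) : (1 : ℝ) ≤ p := by
  have : 0 < p := by exact_mod_cast hp
  exact_mod_cast this

lemma IsLatticePair.one_le_left {x y : ℝ} (h : IsLatticePair x y) (hx : 0 < x) : 1 ≤ x := by
  have hs := sqrt_two_gt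
  obtain ⟨p, q, ⟨rfl, h2⟩ | ⟨rfl, h2⟩⟩ := h
  · exact one_le_of_pos_int hx
  · have := one_le_of_pos_int (pos_of_mul_pos_left hx (by positivity))
    nlinarith

lemma ValueBound.of_scale {l ξ a x y c ξ' a' x' y' : ℝ} (hc : 0 < c)
    (hD : ξ + a = c * (ξ' + a'))
    (hF : (x - ξ * y) * (x + a * y) = c * ((x' - ξ' * y') * (x' + a' * y')))
    (h : ValueBound l ξ' a' x' y') : ValueBound l ξ a x y := by
  unfold ValueBound at *
  rw [hD, hF, abs_mul, abs_of_pos hc]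
  calc c * (ξ' + a') ≤ c * (l * |(x' - ξ' * y') * (x' + a' * y')|) := by gcongr
    _ = _ := by ring

lemma ValueBound.of_inv {l ξ a x y : ℝ} (hξ : 0 < ξ) (ha : 0 < a)
    (h : ValueBound l ξ⁻¹ a⁻¹ y x) : ValueBound l ξ a x y := by
  unfold ValueBound at *
  have h1 : (x - ξ * y) * (x + a * y) = -(ξ * a) * ((y - ξ⁻¹ * x) * (y + a⁻¹ * x)) := by
    field_simp; ring
  have h2 : ξ + a = ξ * a * (ξ⁻¹ + a⁻¹) := by field_simp; ring
  rw [h1, h2, abs_mul, abs_neg, abs_of_pos (mul_pos hξ ha)]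
  calc ξ * a * (ξ⁻¹ + a⁻¹) ≤ ξ * a * (l * |(y - ξ⁻¹ * x) * (y + a⁻¹ * x)|) := by
        have := mul_pos hξ ha
        gcongr
    _ = _ := by ring

/-- The vector lies in the cone spanned by (0, 1) and (√2, 1). On the segment between them the
negative of the form is concave, so the bounds at the two ends give the bound inside, and y ≥ 1
finishes by homogeneity. -/
lemma valueBound_of_le_sqrt_two_mul {l ξ a x y : ℝ} (hl : 0 ≤ l) (ha : 0 < a)
    (hξ : √2 < ξ) (h1 : ξ + a ≤ l * (ξ * a)) (h2 : ξ + a ≤ l * ((ξ - √2) * (a + √2)))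
    (hx : 0 ≤ x) (hy : 1 ≤ y) (hxy : x ≤ √2 * y) : ValueBound l ξ a x y := by
  have hs := sqrt_two_mul_self
  have hs0 : 0 < √2 := by positivity
  unfold ValueBound
  set s := x / (√2 * y) with hsdef
  have hxs : x = s * √2 * y := by rw [hsdef]; field_simp
  have hs1 : s ≤ 1 := (div_le_one (by positivity)).2 hxy
  have hs2 : 0 ≤ s := by positivity
  have hF : (x - ξ * y) * (x + a * y) =
      -(y ^ 2 * ((1 - s) * (ξ * a) + s * ((ξ - √2) * (a + √2)) + 2 * (s * (1 - s)))) := by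
    rw [hxs]; linear_combination (s ^ 2 * y ^ 2 - s * y ^ 2) * hs
  rw [hF, abs_neg]
  refine le_trans ?_ (mul_le_mul_of_nonneg_left (le_abs_self _) hl)
  have h3 : 0 ≤ s * (1 - s) := mul_nonneg hs2 (by linarith)
  have h4 : ξ + a ≤ l * ((1 - s) * (ξ * a) + s * ((ξ - √2) * (a + √2)) + 2 * (s * (1 - s))) := by
    have e1 := mul_le_mul_of_nonneg_left h1 (by linarith : 0 ≤ 1 - s)
    have e2 := mul_le_mul_of_nonneg_left h2 hs2
    have e3 := mul_nonneg hl h3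
    linarith
  have h5 : 1 ≤ y ^ 2 := by nlinarith
  have h6 : 0 ≤ ξ + a := by linarith
  nlinarith

/-- The same interpolation on the cone spanned by (1, 0) and (√2, 1), where the form is positive
with a nonnegative mixed term; here x ≥ √2 supplies the scale x²/2 ≥ 1. -/
lemma valueBound_of_sqrt_two_mul_le {l ξ a x y : ℝ} (hl : 0 ≤ l) (ha : 0 < a)
    (hξ : 0 < ξ) (h1 : ξ + a ≤ l) (h2 : ξ + a ≤ l * ((√2 - ξ) * (√2 + a)))
    (hy : 1 ≤ y) (hxy : √2 * y ≤ x) : ValueBound l ξ a x y := by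
  have hs := sqrt_two_mul_self
  have hs0 := sqrt_two_gt
  unfold ValueBound
  have hx : 0 < x := by nlinarith
  set s := √2 * y / x with hsdef
  have hs1 : s ≤ 1 := (div_le_one (by positivity)).2 hxy
  have hs2 : 0 ≤ s := by positivity
  have hys : y = s * √2 * x / 2 := by
    rw [hsdef]; field_simp; linear_combination -hs
  have hF : (x - ξ * y) * (x + a * y) =
      x ^ 2 / 2 * ((1 - s) * 2 + s * ((√2 - ξ) * (√2 + a)) + ξ * a * (s * (1 - s))) := by
    rw [hys]; linear_combination (-x ^ 2 * s * (1 + s * ξ * a / 2) / 2) * hs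
  rw [hF]
  refine le_trans ?_ (mul_le_mul_of_nonneg_left (le_abs_self _) hl)
  have h3 : 0 ≤ ξ * a * (s * (1 - s)) :=
    mul_nonneg (by positivity) (mul_nonneg hs2 (by linarith))
  have h6 : 0 ≤ ξ + a := by linarith
  have h4 : ξ + a ≤
      l * ((1 - s) * 2 + s * ((√2 - ξ) * (√2 + a)) + ξ * a * (s * (1 - s))) := by
    have e1 := mul_le_mul_of_nonneg_left h1 (by linarith : 0 ≤ 1 - s)
    have e2 := mul_le_mul_of_nonneg_left h2 hs2
    have e3 := mul_nonneg hl h3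
    have e4 : 0 ≤ (1 - s) * l := mul_nonneg (by linarith) hl
    linarith
  have h5 : 2 ≤ x ^ 2 := by
    have : √2 ≤ x := by nlinarith
    nlinarith
  nlinarith

/-- A set of pairs `(ξ, a)` that is closed under following the geodesic from `-a` to `ξ` through
the tessellation by ideal quadrilaterals, with heights at most `l` along the way. -/
structure IsAdmissible (l : ℝ) (S : Set (ℝ × ℝ)) : Prop where
  pos : ∀ p ∈ S, 0 < p.1 ∧ 0 < p.2
  le : ∀ p ∈ S, p.1 + p.2 ≤ l
  inv_le : ∀ p ∈ S, p.1⁻¹ + p.2⁻¹ ≤ l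
  step : ∀ p ∈ S, ∃ ξ', (p.1 = ξ' + √2 ∧ (ξ', p.2 + √2) ∈ S) ∨
    (p.1⁻¹ = ξ'⁻¹ + √2 ∧ (ξ', (p.2⁻¹ + √2)⁻¹) ∈ S) ∨
    (p.1 = (√2 * ξ' + 1) / (ξ' + √2) ∧ (ξ', (√2 * p.2 + 1) / (p.2 + √2)) ∈ S)

lemma add_le_mul_of_inv_le {l ξ a : ℝ} (hξ : 0 < ξ) (ha : 0 < a) (h : ξ⁻¹ + a⁻¹ ≤ l) :
    ξ + a ≤ l * (ξ * a) := by
  have h2 : ξ + a = (ξ⁻¹ + a⁻¹) * (ξ * a) := by field_simp; ring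
  rw [h2]
  have := mul_pos hξ ha
  gcongr

lemma inv_add_inv_le_mul {l ξ a : ℝ} (hξ : 0 < ξ) (ha : 0 < a) (h : ξ + a ≤ l) :
    ξ⁻¹ + a⁻¹ ≤ l * (ξ⁻¹ * a⁻¹) := by
  apply add_le_mul_of_inv_le (inv_pos.2 hξ) (inv_pos.2 ha)
  rwa [inv_inv, inv_inv]

/-- The estimate for a geodesic that crosses a quadrilateral between opposite sides, at the vectors
on the right of it. -/
lemma valueBound_of_opposite {l ξ a ξ' x y : ℝ} (hl : 0 ≤ l) (ha : 0 < a) (hξ' : 0 < ξ')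
    (hξξ' : ξ = (√2 * ξ' + 1) / (ξ' + √2)) (h1 : ξ + a ≤ l)
    (h2 : ξ' + (√2 * a + 1) / (a + √2) ≤ l) (hy : 1 ≤ y) (hxy : √2 * y ≤ x) :
    ValueBound l ξ a x y := by
  have hs := sqrt_two_mul_self
  refine valueBound_of_sqrt_two_mul_le hl ha (by rw [hξξ']; positivity) h1 ?_ hy hxy
  -- The inverse of B carries (√2, 1) to (1, 0), so the condition at (√2, 1) is the height bound for
  -- the next pair.
  have h3 : ξ + a = (ξ' + (√2 * a + 1) / (a + √2)) * ((√2 - ξ) * (√2 + a)) := by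
    have h4 : √2 - ξ = 1 / (ξ' + √2) := by
      rw [hξξ', eq_div_iff (by positivity), sub_mul, div_mul_cancel₀ _ (by positivity)]
      linear_combination hs
    rw [h4, hξξ']; field_simp; ring
  have h4 : 0 < (√2 - ξ) * (√2 + a) := by
    refine mul_pos ?_ (by positivity)
    rw [hξξ', sub_pos, div_lt_iff₀ (by positivity)]
    linarith
  rw [h3]
  gcongr

/-- Induction on a bound for x + y. A vector in the cone through which the geodesic leaves is pulled
back by A, C or B, which lowers x + y by at least 1. Any other vector lies on an axis or in a cone
cut off by a side, where bounds at two vertices suffice. -/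
lemma IsAdmissible.valueBound {l : ℝ} {S : Set (ℝ × ℝ)} (hS : IsAdmissible l S) {p : ℝ × ℝ}
    (hp : p ∈ S) {x y : ℝ} (hx : 0 ≤ x) (hy : 0 ≤ y) (h0 : 0 < x + y) (hL : IsLatticePair x y) :
    ValueBound l p.1 p.2 x y := by
  obtain ⟨n, hn⟩ := exists_nat_ge (x + y)
  have hs := sqrt_two_mul_self
  have hs1 := sqrt_two_gt
  induction n generalizing p x y with
  | zero => exact absurd h0 (by simpa using hn)
  | succ n ih =>
    push_cast at hn
    obtain ⟨ξ, a⟩ := p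
    obtain ⟨hξ, ha⟩ := hS.pos _ hp
    have hle := hS.le _ hp
    have hinv := hS.inv_le _ hp
    obtain ⟨ξ', hstep⟩ := hS.step _ hp
    dsimp only at *
    have hl : 0 ≤ l := by linarith
    rcases hy.eq_or_lt with rfl | hy0
    · have hx1 := hL.one_le_left (by linarith)
      unfold ValueBound
      simp only [mul_zero, sub_zero, add_zero, abs_mul_self]
      nlinarith [mul_le_mul hx1 hx1 zero_le_one hx]
    rcases hx.eq_or_lt with rfl | hx0
    · have hy1 := hL.swap.one_le_left hy0
      have := add_le_mul_of_inv_le hξ ha hinv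
      unfold ValueBound
      rw [show (0 - ξ * y) * (0 + a * y) = -(ξ * a * (y * y)) by ring, abs_neg,
        abs_of_pos (by positivity)]
      nlinarith [mul_le_mul hy1 hy1 zero_le_one hy]
    have hx1 := hL.one_le_left hx0
    have hy1 := hL.swap.one_le_left hy0
    rcases hstep with ⟨hξξ', hmem⟩ | ⟨hξξ', hmem⟩ | ⟨hξξ', hmem⟩
    · obtain ⟨hξ', ha'⟩ := hS.pos _ hmem
      have hinv' := hS.inv_le _ hmem
      dsimp only at hξ' ha' hinv'
      rcases le_or_gt x (√2 * y) with hxy | hxy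
      · refine valueBound_of_le_sqrt_two_mul hl ha (by linarith)
          (add_le_mul_of_inv_le hξ ha hinv) ?_ hx hy1 hxy
        rw [hξξ', add_sub_cancel_right]
        exact (by linarith : _ = ξ' + (a + √2)).trans_le (add_le_mul_of_inv_le hξ' ha' hinv')
      · refine ValueBound.of_scale one_pos (ξ' := ξ') (a' := a + √2) (x' := x - √2 * y) (y' := y)
          (by rw [hξξ']; ring) (by rw [hξξ']; ring) ?_
        exact ih hmem (by linarith) hy (by linarith) hL.sub_sqrt_two_mul (by nlinarith)
    · obtain ⟨hξ', ha'⟩ := hS.pos _ hmem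
      have hle' := hS.le _ hmem
      dsimp only at hξ' ha' hle'
      rcases le_or_gt y (√2 * x) with hxy | hxy
      · refine ValueBound.of_inv hξ ha (valueBound_of_le_sqrt_two_mul hl (inv_pos.2 ha)
          (by rw [hξξ']; linarith [inv_pos.2 hξ']) (inv_add_inv_le_mul hξ ha hle) ?_ hy hx1 hxy)
        have h3 := inv_add_inv_le_mul hξ' ha' hle'
        rw [inv_inv] at h3
        rw [hξξ', add_sub_cancel_right]
        linarith
      · have hξ2 : ξ = ξ' / (1 + √2 * ξ') := by
          rw [← inv_inj, hξξ', inv_div]; field_simp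
        have ha2 : (a⁻¹ + √2)⁻¹ = a / (1 + √2 * a) := by
          rw [← inv_inj, inv_inv, inv_div]; field_simp
        refine ValueBound.of_scale (c := (1 + √2 * a) / (1 + √2 * ξ')) (by positivity)
          (ξ' := ξ') (a' := (a⁻¹ + √2)⁻¹) (x' := x) (y' := y - √2 * x) ?_ ?_ ?_
        · rw [ha2, hξ2]; field_simp; ring
        · rw [ha2, hξ2]; field_simp; ring
        · exact ih hmem hx (by linarith) (by linarith) hL.swap.sub_sqrt_two_mul.swap (by nlinarith)
    · obtain ⟨hξ', ha'⟩ := hS.pos _ hmem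
      have hle' := hS.le _ hmem
      have hinv' := hS.inv_le _ hmem
      dsimp only at hξ' ha' hle' hinv'
      rcases le_or_gt (√2 * y) x with hxy | hxy
      · exact valueBound_of_opposite hl ha hξ' hξξ' hle hle' hy1 hxy
      rcases le_or_gt (√2 * x) y with hyx | hyx
      · refine ValueBound.of_inv hξ ha (valueBound_of_opposite hl (inv_pos.2 ha)
          (inv_pos.2 hξ') ?_ hinv ?_ hx1 hyx)
        · rw [hξξ', inv_div]; field_simp; ring
        · refine le_trans (le_of_eq ?_) hinv'
          rw [inv_div]; field_simp; ring
      · refine ValueBound.of_scale (c := (a + √2) / (ξ' + √2)) (by positivity)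
          (ξ' := ξ') (a' := (√2 * a + 1) / (a + √2)) (x' := √2 * x - y) (y' := √2 * y - x) ?_ ?_ ?_
        · rw [hξξ']; field_simp; ring
        · have e1 : √2 * x - y - ξ' * (√2 * y - x) = (ξ' + √2) * (x - ξ * y) := by
            rw [hξξ']; field_simp; ring
          have e2 : √2 * x - y + (√2 * a + 1) / (a + √2) * (√2 * y - x) =
              (x + a * y) / (a + √2) := by
            field_simp; linear_combination (x + a * y) * hs
          rw [e1, e2]; field_simp
        -- The new sum is (√2 - 1)(x + y); since x and y are at least 1, it drops by at least 2(2 -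
        -- √2) > 1.
        · exact ih hmem (by linarith) (by linarith) (by nlinarith) hL.rotate (by nlinarith)

end HeckeSpectra

/-! ### The coded geodesics and their height bounds -/

namespace HeckeSpectra

open Filter Topology

/-- The exponents `N, N + 1 + d 0, N + 1 + d 1, …`. -/
def codeSeq (N : ℕ) (d : ℕ → Fin 2) : ℕ → ℕ
  | 0 => N
  | i + 1 => N + 1 + d i

/-- A sequence that contains all initial segments of `codeSeq N d`, each of them after a term that
is larger than the earlier ones. -/
def markedSeq (N : ℕ) (d : ℕ → Fin 2) (t : ℕ) : ℕ :=
  if t = t.sqrt * t.sqrt then N + 3 + t.sqrt else codeSeq N d (t - t.sqrt * t.sqrt - 1)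

/-- The number with the expansion `markedSeq N d t, markedSeq N d (t + 1), …`. -/
noncomputable def future (N : ℕ) (d : ℕ → Fin 2) (t : ℕ) : ℝ :=
  blockLimit fun i => markedSeq N d (t + i)

/-- The number with the expansion `markedSeq N d (t - 1), …, markedSeq N d 0`. -/
noncomputable def past (N : ℕ) (d : ℕ → Fin 2) : ℕ → ℝ
  | 0 => 1
  | t + 1 => blockMap (markedSeq N d t) (past N d t)

/-- The Lagrange number of the form that is coded by `markedSeq N d`. -/
noncomputable def codeValue (N : ℕ) (d : ℕ → Fin 2) : ℝ := acMap (blockLimit (codeSeq N d)) + 1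

variable (N : ℕ) (d : ℕ → Fin 2)

lemma lt_codeSeq {i : ℕ} (hi : i ≠ 0) : N < codeSeq N d i := by
  obtain ⟨i, rfl⟩ := Nat.exists_eq_succ_of_ne_zero hi
  simp only [codeSeq]; omega

lemma codeSeq_le (i : ℕ) : codeSeq N d i ≤ N + 2 := by
  cases i with
  | zero => simp [codeSeq]
  | succ i => simp only [codeSeq]; have := (d i).is_lt; omega

lemma markedSeq_mul_self (s : ℕ) : markedSeq N d (s * s) = N + 3 + s := by
  simp [markedSeq, Nat.sqrt_eq]

lemma markedSeq_mul_self_add {s i : ℕ} (hi : i < 2 * s) :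
    markedSeq N d (s * s + 1 + i) = codeSeq N d i := by
  have h : (s * s + 1 + i).sqrt = s := by
    rw [add_assoc]; exact Nat.sqrt_add_eq s (by omega)
  unfold markedSeq
  rw [h, if_neg (by omega)]
  congr 1; omega

lemma lt_markedSeq_or (t : ℕ) : N < markedSeq N d t ∨ ∃ s, 0 < s ∧ t = s * s + 1 := by
  unfold markedSeq
  split_ifs with h
  · left; omega
  · by_cases h1 : t - t.sqrt * t.sqrt - 1 = 0
    · right
      have h2 := Nat.sqrt_le t
      refine ⟨t.sqrt, ?_, by omega⟩
      rw [Nat.sqrt_pos]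
      by_contra h3
      have : t = 0 := by omega
      subst this
      simp at h
    · exact Or.inl (lt_codeSeq N d h1)

lemma le_markedSeq (t : ℕ) : N ≤ markedSeq N d t := by
  rcases lt_markedSeq_or N d t with h | ⟨s, hs, rfl⟩
  · exact h.le
  · rw [← add_zero (s * s + 1), markedSeq_mul_self_add N d (by omega)]
    exact le_rfl

lemma one_le_future (t : ℕ) : 1 ≤ future N d t := one_le_blockLimit _

lemma future_pos (t : ℕ) : 0 < future N d t := zero_lt_one.trans_le (one_le_future N d t)

lemma future_eq (t : ℕ) :
    future N d t = blockMap (markedSeq N d t) (future N d (t + 1)) := by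
  unfold future
  rw [blockLimit_eq]
  simp only [add_zero, add_assoc, add_comm 1]

lemma one_le_past (t : ℕ) : 1 ≤ past N d t := by
  induction t with
  | zero => exact le_rfl
  | succ t ih => exact one_le_blockMap _ (by linarith)

lemma past_pos (t : ℕ) : 0 < past N d t := zero_lt_one.trans_le (one_le_past N d t)

lemma blockMap_le_blockLimit_of_lt {j : ℕ → ℕ} {k : ℕ} (h : j 0 < k) {x : ℝ} (hx : 0 < x) :
    blockMap k x ≤ blockLimit j := by
  rw [blockLimit_eq]
  exact blockMap_le_of_lt h hx (by linarith [one_le_blockLimit fun i => j (i + 1)])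

/-- Backward induction from the next marker at (s + 1)². The marker exceeds every exponent of
`codeSeq`, so cutting the segment off there can only lower the number. -/
lemma future_le_blockLimit_tail {s i e : ℕ} (h : i + e = 2 * s) :
    future N d (s * s + 1 + i) ≤ blockLimit fun k => codeSeq N d (i + k) := by
  induction e generalizing i with
  | zero =>
    rw [future_eq, show s * s + 1 + i = (s + 1) * (s + 1) by rw [← add_zero i, h]; ring,
      markedSeq_mul_self]
    apply blockMap_le_blockLimit_of_lt _ (future_pos N d _)
    have := codeSeq_le N d (i + 0)
    omega
  | succ e ih =>
    rw [future_eq, markedSeq_mul_self_add N d (by omega), blockLimit_eq]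
    refine blockMap_le_blockMap _ (future_pos N d _) ?_
    have := ih (i := i + 1) (by omega)
    rw [← add_assoc] at this
    refine this.trans_eq ?_
    congr 1; funext k; congr 1; omega

lemma future_le (t : ℕ) : future N d t ≤ blockLimit (codeSeq N d) := by
  rcases lt_markedSeq_or N d t with h | ⟨s, hs, rfl⟩
  · rw [future_eq]
    exact blockMap_le_blockLimit_of_lt h (future_pos N d _)
  · have := future_le_blockLimit_tail N d (s := s) (i := 0) (e := 2 * s) (by omega)
    simpa using this

/-- Read backwards, an exponent N is followed by the marker before it, which exceeds `codeSeq N d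
1`; any other first exponent already exceeds N. -/
lemma past_le (t : ℕ) : past N d t ≤ blockLimit (codeSeq N d) := by
  cases t with
  | zero => exact one_le_blockLimit _
  | succ t =>
    rcases lt_markedSeq_or N d t with h | ⟨s, hs, rfl⟩
    · exact blockMap_le_blockLimit_of_lt h (past_pos N d _)
    · have h1 : markedSeq N d (s * s + 1) = codeSeq N d 0 :=
        markedSeq_mul_self_add N d (i := 0) (by omega)
      rw [past, h1, blockLimit_eq]
      refine blockMap_le_blockMap _ (past_pos N d _) ?_
      rw [past, markedSeq_mul_self]
      apply blockMap_le_blockLimit_of_lt _ (past_pos N d _)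
      have := codeSeq_le N d (0 + 1)
      omega

lemma acMap_eq_inv {x : ℝ} (hx : 0 < x) : acMap x = (√2 + x⁻¹)⁻¹ + √2 := by
  unfold acMap
  rw [add_comm]; congr 1
  field_simp

/-- The pairs of end points along the geodesic coded by `markedSeq N d`. -/
def codePairs : Set (ℝ × ℝ) :=
  {p | ∃ t, p = (acMap (future N d t), (past N d t)⁻¹)} ∪
  {p | ∃ t, p = ((√2 + (future N d t)⁻¹)⁻¹, (past N d t)⁻¹ + √2)} ∪
  {p | ∃ t i k, i + k = markedSeq N d t ∧
    p = (beta (betaRatio ^ i) (acMap (future N d (t + 1))),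
      (beta (betaRatio ^ k) (acMap (past N d t)))⁻¹)}

lemma codePair_mem (t : ℕ) : (acMap (future N d t), (past N d t)⁻¹) ∈ codePairs N d :=
  Or.inl (Or.inl ⟨t, rfl⟩)

lemma add_inv_le_codeValue {x y : ℝ} (hx : 0 < x) (hx1 : x ≤ blockLimit (codeSeq N d))
    (hy : 1 ≤ y) : acMap x + y⁻¹ ≤ codeValue N d := by
  have h1 := acMap_le_acMap hx.le hx1
  have h2 := inv_le_one_of_one_le₀ hy
  unfold codeValue; linarith

lemma sqrt_two_add_one_lt_codeValue : √2 + 1 < codeValue N d := by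
  have := sqrt_two_lt_acMap (by linarith [one_le_blockLimit (codeSeq N d)] :
    0 < blockLimit (codeSeq N d))
  unfold codeValue; linarith

lemma past_le_sqrt_two (hN : 0 < N) (t : ℕ) : past N d t ≤ √2 := by
  cases t with
  | zero => exact (by linarith [sqrt_two_gt] : (1 : ℝ) ≤ √2)
  | succ t =>
    have := le_markedSeq N d t
    exact beta_betaRatio_pow_le (by omega) (one_le_acMap (past_pos N d t))

lemma one_le_beta_acMap (i : ℕ) {x : ℝ} (hx : 0 < x) : 1 ≤ beta (betaRatio ^ i) (acMap x) :=
  one_le_beta (betaRatio_pow_pos i) (betaRatio_pow_le_one i) (one_le_acMap hx)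

/-- The block is traversed as A, C, then the run of B. At the ends of a run the heights are bounded
by `future_le` and `past_le`; inside it they are at most √2 + 1, which is below `codeValue N d`. The
exponents i and k count the factors B still ahead and already passed. -/
lemma isAdmissible_codePairs (hN : 0 < N) : IsAdmissible (codeValue N d) (codePairs N d) := by
  have hl := sqrt_two_add_one_lt_codeValue N d
  have hfirst : ∀ t, acMap (future N d t) + (past N d t)⁻¹ ≤ codeValue N d := fun t =>
    add_inv_le_codeValue N d (future_pos N d t) (future_le N d t) (one_le_past N d t)
  have hsecond : ∀ t, acMap (past N d t) + (future N d t)⁻¹ ≤ codeValue N d := fun t =>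
    add_inv_le_codeValue N d (past_pos N d t) (past_le N d t) (one_le_future N d t)
  have hfirst' : ∀ t, (acMap (future N d t))⁻¹ + past N d t ≤ codeValue N d := fun t => by
    have h1 := inv_le_one_of_one_le₀ (one_le_acMap (future_pos N d t))
    have h2 := past_le_sqrt_two N d hN t
    linarith
  have hfpos := future_pos N d
  have hppos := past_pos N d
  have hb0 : ∀ (i : ℕ) {x : ℝ}, 0 < x → 0 < beta (betaRatio ^ i) (acMap x) := fun i x hx =>
    zero_lt_one.trans_le (one_le_beta_acMap i hx)
  constructor
  · rintro _ ((⟨t, rfl⟩ | ⟨t, rfl⟩) | ⟨t, i, k, -, rfl⟩) <;> dsimp only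
    · exact ⟨by linarith [one_le_acMap (hfpos t)], inv_pos.2 (hppos t)⟩
    · have h1 := hfpos t
      have h2 := hppos t
      constructor <;> positivity
    · exact ⟨hb0 i (hfpos _), inv_pos.2 (hb0 k (hppos _))⟩
  · rintro _ ((⟨t, rfl⟩ | ⟨t, rfl⟩) | ⟨t, i, k, hik, rfl⟩) <;> dsimp only
    · exact hfirst t
    · have := hfirst t
      rw [acMap_eq_inv (hfpos t)] at this
      linarith
    · rcases Nat.eq_zero_or_pos i with rfl | hi
      · rw [pow_zero, beta_one]
        rw [zero_add] at hik
        have := hfirst (t + 1)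
        rwa [past, ← hik] at this
      · have h1 := beta_betaRatio_pow_le hi.ne' (one_le_acMap (hfpos (t + 1)))
        have h2 := inv_le_one_of_one_le₀ (one_le_beta_acMap k (hppos t))
        linarith
  · rintro _ ((⟨t, rfl⟩ | ⟨t, rfl⟩) | ⟨t, i, k, hik, rfl⟩) <;> dsimp only
    · rw [inv_inv]; exact hfirst' t
    · have := hsecond t
      rw [acMap_eq_inv (hppos t)] at this
      rw [inv_inv, add_comm (past N d t)⁻¹]
      linarith
    · rw [inv_inv]
      rcases Nat.eq_zero_or_pos k with rfl | hk
      · rw [pow_zero, beta_one]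
        rw [add_zero] at hik
        have := hsecond t
        rw [future_eq, ← hik] at this
        unfold blockMap at this
        linarith
      · have h1 := beta_betaRatio_pow_le hk.ne' (one_le_acMap (hppos t))
        have h2 := inv_le_one_of_one_le₀ (one_le_beta_acMap i (hfpos (t + 1)))
        linarith
  · rintro _ ((⟨t, rfl⟩ | ⟨t, rfl⟩) | ⟨t, i, k, hik, rfl⟩) <;> dsimp only
    · exact ⟨_, Or.inl ⟨acMap_eq_inv (hfpos t), Or.inl (Or.inr ⟨t, rfl⟩)⟩⟩
    · refine ⟨future N d t, Or.inr (Or.inl ⟨by rw [inv_inv, add_comm], Or.inr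
        ⟨t, markedSeq N d t, 0, by omega, ?_⟩⟩)⟩
      rw [pow_zero, beta_one, acMap_eq_inv (hppos t), future_eq, blockMap,
        add_comm (past N d t)⁻¹]
    · cases i with
      | zero =>
        rw [zero_add] at hik
        refine ⟨(√2 + (future N d (t + 1))⁻¹)⁻¹, Or.inl ⟨?_, Or.inl (Or.inr ⟨t + 1, ?_⟩)⟩⟩
        · rw [pow_zero, beta_one, acMap_eq_inv (hfpos _)]
        · rw [past, ← hik, blockMap]
      | succ i =>
        refine ⟨beta (betaRatio ^ i) (acMap (future N d (t + 1))), Or.inr (Or.inr ⟨?_, Or.inr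
          ⟨t, i, k + 1, by omega, ?_⟩⟩)⟩
        · rw [beta_betaRatio_pow_succ i (by linarith [one_le_acMap (hfpos (t + 1))]),
            beta_betaRatio (hb0 i (hfpos _))]
        · congr 1
          have h1 := hb0 k (hppos t)
          rw [beta_betaRatio_pow_succ k (by linarith [one_le_acMap (hppos t)]),
            beta_betaRatio h1, inv_div]
          field_simp; ring

/-- The root 1 is fixed by B, and each step moves w ≥ 1 towards 1, so the sum never grows. This
covers vectors with coordinates of opposite sign, for which `codeForm` has the roots 1 and `-acMap
(future N d 0)`. -/
lemma isAdmissible_one {l : ℝ} (hl : 2 ≤ l) :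
    IsAdmissible l {p | p.1 = 1 ∧ 1 ≤ p.2 ∧ 1 + p.2 ≤ l} where
  pos := by rintro ⟨_, w⟩ ⟨rfl, h1, h2⟩; exact ⟨one_pos, by dsimp only at *; linarith⟩
  le := by rintro ⟨_, w⟩ ⟨rfl, h1, h2⟩; exact h2
  inv_le := by
    rintro ⟨_, w⟩ ⟨rfl, h1, h2⟩
    have := inv_le_one_of_one_le₀ h1
    dsimp only at *
    rw [inv_one]; linarith
  step := by
    rintro ⟨_, w⟩ ⟨rfl, h1, h2⟩
    dsimp only at h1 h2
    have hs := sqrt_two_gt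
    refine ⟨1, Or.inr (Or.inr ⟨?_, rfl, ?_, ?_⟩)⟩ <;> dsimp only
    · rw [mul_one, add_comm, div_self (by positivity)]
    · rw [le_div_iff₀ (by linarith)]; nlinarith
    · have : (√2 * w + 1) / (w + √2) ≤ w := by
        rw [div_le_iff₀ (by linarith)]; nlinarith
      linarith

end HeckeSpectra

/-! ### The form with the prescribed Lagrange number -/

namespace HeckeSpectra

open Filter Topology

/-- The matrix `(1, 0; √2, 1)`. -/
noncomputable def lowerMat : SL(2, ℝ) := ⟨!![1, 0; √2, 1], by simp [Matrix.det_fin_two]⟩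

/-- The matrix `(√2, 1; 1, √2)`. -/
noncomputable def middleMat : SL(2, ℝ) :=
  ⟨!![√2, 1; 1, √2], by
    rw [Matrix.det_fin_two_of, sqrt_two_mul_self]; norm_num⟩

lemma heckeS_mem : heckeS ∈ heckeGroup 4 := Subgroup.subset_closure (by simp)

lemma lowerMat_mem : lowerMat ∈ heckeGroup 4 := by
  have h : lowerMat = heckeS * translation ((-1 : ℤ) * √2) * heckeS⁻¹ := by
    rw [eq_mul_inv_iff_mul_eq]
    ext i j
    rw [mul_entry, mul_entry]
    fin_cases i <;> fin_cases j <;> simp [lowerMat, heckeS, translation]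
  rw [h]
  exact mul_mem (mul_mem heckeS_mem (translation_mem _)) (inv_mem heckeS_mem)

lemma middleMat_mem : middleMat ∈ heckeGroup 4 := by
  have h : middleMat = translation √2 * heckeS * translation √2 := by
    ext i j
    rw [mul_entry, mul_entry, mul_entry]
    have hs := sqrt_two_mul_self
    fin_cases i <;> fin_cases j <;> simp [middleMat, heckeS, translation]
    norm_num
  rw [h]
  exact mul_mem (mul_mem translation_sqrt_two_mem heckeS_mem) translation_sqrt_two_mem

/-- Some matrix of the group with nonnegative entries, the first of them at least `m`, maps `f` to
a form with roots `ξ` and `-a`. -/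
def Reaches (f : BinForm) (D m ξ a : ℝ) : Prop :=
  ∃ M ∈ heckeGroup 4, 1 ≤ M 0 0 ∧ m ≤ M 0 0 ∧ 0 ≤ M 0 1 ∧ 0 ≤ M 1 0 ∧ 0 ≤ M 1 1 ∧
    ∀ w : Fin 2 → ℝ, f.eval (Matrix.mulVec (M : Matrix (Fin 2) (Fin 2) ℝ) w) * (ξ + a) =
      D * ((w 0 - ξ * w 1) * (w 0 + a * w 1))

variable {f : BinForm} {D m ξ a ξ' a' : ℝ}

lemma eval_mul_of_eval {M P : SL(2, ℝ)} {c : ℝ} (hc : c ≠ 0)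
    (h : ∀ w : Fin 2 → ℝ, f.eval (Matrix.mulVec (M : Matrix (Fin 2) (Fin 2) ℝ) w) * (ξ + a) =
      D * ((w 0 - ξ * w 1) * (w 0 + a * w 1)))
    (hD : ξ + a = c * (ξ' + a'))
    (hF : ∀ x y : ℝ, (P 0 0 * x + P 0 1 * y - ξ * (P 1 0 * x + P 1 1 * y)) *
      (P 0 0 * x + P 0 1 * y + a * (P 1 0 * x + P 1 1 * y)) =
        c * ((x - ξ' * y) * (x + a' * y))) (w : Fin 2 → ℝ) :
    f.eval (Matrix.mulVec ((M * P : SL(2, ℝ)) : Matrix (Fin 2) (Fin 2) ℝ) w) * (ξ' + a') =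
      D * ((w 0 - ξ' * w 1) * (w 0 + a' * w 1)) := by
  have h1 := h (Matrix.mulVec (P : Matrix (Fin 2) (Fin 2) ℝ) w)
  rw [Matrix.mulVec_mulVec, ← Matrix.SpecialLinearGroup.coe_mul, hD, mulVec_zero, mulVec_one,
    hF] at h1
  apply mul_left_cancel₀ hc
  linear_combination h1

/-- Multiplication by A C turns the first entry into 3 `M 0 0` + √2 `M 0 1`; this growth later makes
the vectors found distinct. -/
lemma Reaches.upper_lower (hξ : 0 < ξ) (ha : 0 < a) (h : Reaches f D m (acMap ξ) a⁻¹) :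
    Reaches f D (m + 1) ξ (acMap a)⁻¹ := by
  obtain ⟨M, hM, h1, h2, h3, h4, h5, h6⟩ := h
  have hs := sqrt_two_gt
  have h8 : (M 0 0 * √2 + M 0 1) * √2 = 2 * M 0 0 + M 0 1 * √2 := by
    linear_combination M 0 0 * sqrt_two_mul_self
  have h9 : 0 ≤ M 0 1 * √2 := by positivity
  have e1 := acMap_eq_inv hξ
  have e2 : (√2 + ξ⁻¹)⁻¹ = ξ / (√2 * ξ + 1) := by field_simp
  have e3 : (acMap a)⁻¹ = (√2 * a + 1) / (a + √2 * (√2 * a + 1)) := by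
    unfold acMap; field_simp; ring
  have h7 := eval_mul_of_eval (P := translation √2) (ξ' := (√2 + ξ⁻¹)⁻¹) (a' := a⁻¹ + √2)
    one_ne_zero h6 (by rw [e1]; ring) (fun x y => by rw [e1]; simp [translation]; ring)
  refine ⟨M * translation √2 * lowerMat,
    mul_mem (mul_mem hM translation_sqrt_two_mem) lowerMat_mem, ?_, ?_, ?_, ?_, ?_,
    eval_mul_of_eval (c := (a + √2 * (√2 * a + 1)) / (a * (√2 * ξ + 1))) (by positivity) h7
      ?_ fun x y => ?_⟩
  any_goals rw [mul_entry, mul_entry, mul_entry]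
  any_goals simp [lowerMat, translation]
  · linarith
  · linarith
  · positivity
  · positivity
  · positivity
  · rw [e2, e3]; field_simp; ring
  · rw [e2, e3]; field_simp; ring

lemma Reaches.middle (hξ : 0 < ξ) (ha : 0 < a) (h : Reaches f D m (beta betaRatio ξ) a⁻¹) :
    Reaches f D m ξ (beta betaRatio a)⁻¹ := by
  obtain ⟨M, hM, h1, h2, h3, h4, h5, h6⟩ := h
  have hs := sqrt_two_gt
  have hs2 := sqrt_two_mul_self
  rw [beta_betaRatio hξ] at h6
  rw [beta_betaRatio ha, inv_div]
  refine ⟨M * middleMat, mul_mem hM middleMat_mem, ?_, ?_, ?_, ?_, ?_,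
    eval_mul_of_eval (c := (√2 * a + 1) / (a * (ξ + √2))) (by positivity) h6
      ?_ fun x y => ?_⟩
  any_goals rw [mul_entry]
  any_goals simp [middleMat]
  · nlinarith
  · nlinarith
  · positivity
  · positivity
  · positivity
  · field_simp; ring
  · have k1 : √2 * x + y - (√2 * ξ + 1) / (ξ + √2) * (x + √2 * y) = (x - ξ * y) / (ξ + √2) := by
      field_simp; linear_combination (x - ξ * y) * hs2
    have k2 : √2 * x + y + a⁻¹ * (x + √2 * y) =
        (√2 * a + 1) / a * (x + (a + √2) / (√2 * a + 1) * y) := by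
      field_simp; ring
    rw [k1, k2]; field_simp

lemma Reaches.middle_pow (j : ℕ) {i : ℕ} (hξ : 1 ≤ ξ) (ha : 1 ≤ a)
    (h : Reaches f D m (beta (betaRatio ^ (j + i)) ξ) (beta (betaRatio ^ 0) a)⁻¹) :
    Reaches f D m (beta (betaRatio ^ i) ξ) (beta (betaRatio ^ j) a)⁻¹ := by
  induction j generalizing i with
  | zero => simpa using h
  | succ j ih =>
    have hξ' := one_le_beta (betaRatio_pow_pos i) (betaRatio_pow_le_one i) hξ
    have ha' := one_le_beta (betaRatio_pow_pos j) (betaRatio_pow_le_one j) ha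
    have h1 := ih (i := i + 1) (by rwa [add_right_comm] at h)
    rw [beta_betaRatio_pow_succ _ (by linarith)] at h1 ⊢
    exact h1.middle (by linarith) (by linarith)

lemma Reaches.block (N : ℕ) (d : ℕ → Fin 2) (t : ℕ)
    (h : Reaches f D m (acMap (future N d t)) (past N d t)⁻¹) :
    Reaches f D (m + 1) (acMap (future N d (t + 1))) (past N d (t + 1))⁻¹ := by
  have h1 := h.upper_lower (future_pos N d t) (past_pos N d t)
  rw [future_eq, blockMap, ← add_zero (markedSeq N d t)] at h1
  have h2 := Reaches.middle_pow (markedSeq N d t) (i := 0)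
    (one_le_acMap (future_pos N d (t + 1)))
    (one_le_acMap (past_pos N d t)) (by rwa [pow_zero, beta_one])
  rwa [pow_zero, beta_one] at h2

/-- The form with roots `acMap (future N d 0)` and `-1`. -/
noncomputable def codeForm (N : ℕ) (d : ℕ → Fin 2) : BinForm :=
  ⟨1, 1 - acMap (future N d 0), -acMap (future N d 0)⟩

section codeForm

variable (N : ℕ) (d : ℕ → Fin 2)

lemma eval_codeForm (v : Fin 2 → ℝ) : (codeForm N d).eval v =
    (v 0 - acMap (future N d 0) * v 1) * (v 0 + v 1) := by
  simp only [BinForm.eval, codeForm]; ring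

lemma one_add_acMap_pos : 0 < 1 + acMap (future N d 0) := by
  linarith [one_le_acMap (future_pos N d 0)]

lemma disc_codeForm : (codeForm N d).disc = (1 + acMap (future N d 0)) ^ 2 := by
  simp only [BinForm.disc, codeForm]; ring

lemma sqrt_disc_codeForm : √(codeForm N d).disc = 1 + acMap (future N d 0) := by
  rw [disc_codeForm, Real.sqrt_sq (one_add_acMap_pos N d).le]

lemma reaches_codeForm (t : ℕ) : Reaches (codeForm N d) (1 + acMap (future N d 0)) t
    (acMap (future N d t)) (past N d t)⁻¹ := by
  induction t with
  | zero =>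
    refine ⟨1, one_mem _, by simp, by simp, by simp, by simp, by simp, fun w => ?_⟩
    rw [Matrix.SpecialLinearGroup.coe_one, Matrix.one_mulVec, eval_codeForm, past, inv_one]
    ring
  | succ t ih =>
    push_cast
    exact ih.block N d t

/-- The zero (-1, 1) has coordinate ratio -1, whereas nonzero lattice vectors have a ratio in √2 ℚ
or a vanishing coordinate. -/
lemma hasNonCuspidalZero_codeForm : HasNonCuspidalZero (heckeGroup 4) (codeForm N d) := by
  refine ⟨![-1, 1], fun h => by simpa using congrFun h 1, by simp [eval_codeForm], ?_⟩
  intro v hv t h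
  have h0 := congrFun h 0
  have h1 := congrFun h 1
  simp only [Matrix.cons_val_zero, Matrix.cons_val_one, Matrix.cons_val_fin_one,
    Pi.smul_apply, smul_eq_mul] at h0 h1
  have ht : t ≠ 0 := by rintro rfl; simp at h1
  have h2 : v 0 = -v 1 := mul_left_cancel₀ ht (by linarith)
  have hirr : ∀ p q : ℤ, (p : ℝ) = q * √2 → q = 0 := by
    intro p q hpq
    by_contra hq
    exact (irrational_sqrt_two.intCast_mul hq).ne_int p hpq.symm
  obtain ⟨p, q, ⟨h3, h4⟩ | ⟨h3, h4⟩⟩ := cuspOrbit_subset_heckeLattice hv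
  · have := hirr p (-q) (by rw [← h3, h2, h4]; push_cast; ring)
    have hq : q = 0 := by omega
    rw [h4, hq] at h1
    simp at h1
  · have := hirr (-q) p (by push_cast; rw [← h3, ← h4, h2])
    rw [h3, this] at h0
    simp at h0

lemma le_codeValue_mul_abs_eval (hN : 0 < N) {v : Fin 2 → ℝ}
    (hv : v ∈ cuspOrbit (heckeGroup 4)) :
    1 + acMap (future N d 0) ≤ codeValue N d * |(codeForm N d).eval v| := by
  have hL : IsLatticePair (v 0) (v 1) := cuspOrbit_subset_heckeLattice hv
  have hne := ne_zero_of_mem_cuspOrbit hv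
  have hne' : v 0 ≠ 0 ∨ v 1 ≠ 0 := by
    by_contra! hcon
    apply hne
    ext i; fin_cases i
    · exact hcon.1
    · exact hcon.2
  have hl := sqrt_two_add_one_lt_codeValue N d
  have hs := sqrt_two_gt
  have hpos : ∀ x y : ℝ, 0 ≤ x → 0 ≤ y → 0 < x + y → IsLatticePair x y →
      1 + acMap (future N d 0) ≤
        codeValue N d * |(x - acMap (future N d 0) * y) * (x + y)| := by
    intro x y hx hy h0 h
    have := (isAdmissible_codePairs N d hN).valueBound (codePair_mem N d 0) hx hy h0 h
    simpa [ValueBound, past, add_comm] using this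
  have hneg : ∀ x y : ℝ, 0 ≤ x → 0 ≤ y → 0 < x + y → IsLatticePair x y →
      1 + acMap (future N d 0) ≤
        codeValue N d * |(x - y) * (x + acMap (future N d 0) * y)| := by
    intro x y hx hy h0 h
    have hmem : ((1, acMap (future N d 0)) : ℝ × ℝ) ∈
        {p : ℝ × ℝ | p.1 = 1 ∧ 1 ≤ p.2 ∧ 1 + p.2 ≤ codeValue N d} := by
      refine ⟨rfl, one_le_acMap (future_pos N d 0), ?_⟩
      have := (isAdmissible_codePairs N d hN).le _ (codePair_mem N d 0)
      simp only [past, inv_one] at this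
      dsimp only
      linarith
    have := (isAdmissible_one (l := codeValue N d) (by linarith)).valueBound hmem hx hy h0 h
    simpa [ValueBound] using this
  rw [eval_codeForm]
  rcases le_total 0 (v 0) with hx | hx <;> rcases le_total 0 (v 1) with hy | hy
  · exact hpos _ _ hx hy (by rcases hne' with h | h <;> positivity) hL
  · have := hneg (v 0) (-v 1) hx (by linarith)
      (by rcases hne' with h | h
          · have := lt_of_le_of_ne hx h.symm; linarith
          · have := lt_of_le_of_ne hy h; linarith) hL.swap.neg_left.swap
    rw [mul_comm (v 0 - _)]
    convert! this using 4 <;> ring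
  · have := hneg (-v 0) (v 1) (by linarith) hy
      (by rcases hne' with h | h
          · have := lt_of_le_of_ne hx h; linarith
          · have := lt_of_le_of_ne hy h.symm; linarith) hL.neg_left
    rw [show (-v 0 - v 1) * (-v 0 + acMap (future N d 0) * v 1) =
      (v 0 - acMap (future N d 0) * v 1) * (v 0 + v 1) by ring] at this
    exact this
  · have := hpos (-v 0) (-v 1) (by linarith) (by linarith)
      (by rcases hne' with h | h
          · have := lt_of_le_of_ne hx h; linarith
          · have := lt_of_le_of_ne hy h; linarith) hL.neg_left.swap.neg_left.swap
    rw [show (-v 0 - acMap (future N d 0) * -v 1) * (-v 0 + -v 1) =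
      (v 0 - acMap (future N d 0) * v 1) * (v 0 + v 1) by ring] at this
    exact this

lemma tendsto_betaRatio_pow : Tendsto (fun n : ℕ => betaRatio ^ n) atTop (𝓝 0) :=
  tendsto_pow_atTop_nhds_zero_of_lt_one betaRatio_pos.le betaRatio_lt_one

/-- After the marker at s² the next 2s exponents agree with `codeSeq`, and the marker N + 3 + s
pushes the past to the fixed point 1. -/
lemma tendsto_height : Tendsto (fun s : ℕ => acMap (future N d (s * s + 1)) +
    (past N d (s * s + 1))⁻¹) atTop (𝓝 (codeValue N d)) := by
  have hX : Tendsto (fun s : ℕ => future N d (s * s + 1)) atTop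
      (𝓝 (blockLimit (codeSeq N d))) := by
    refine tendsto_of_tendsto_of_tendsto_of_le_of_le ((tendsto_blockIter (codeSeq N d)).comp
      (tendsto_id.const_mul_atTop' (two_pos : 0 < 2))) tendsto_const_nhds (fun s => ?_)
      (fun s => future_le N d _)
    refine (le_of_eq ?_).trans (blockIter_le_blockLimit (2 * s) _)
    exact blockIter_congr fun i hi => (markedSeq_mul_self_add N d hi).symm
  have hY : Tendsto (fun s : ℕ => past N d (s * s + 1)) atTop (𝓝 1) := by
    have h1 : Tendsto (fun s : ℕ => 1 + 4 * betaRatio ^ (N + 3 + s)) atTop (𝓝 (1 + 4 * 0)) :=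
      ((tendsto_betaRatio_pow.comp (tendsto_atTop_mono (fun s => Nat.le_add_left s (N + 3))
        tendsto_id)).const_mul
        4).const_add 1
    rw [mul_zero, add_zero] at h1
    refine tendsto_of_tendsto_of_tendsto_of_le_of_le tendsto_const_nhds h1
      (fun s => one_le_past N d _) (fun s => ?_)
    have := blockMap_sub_one_le (markedSeq N d (s * s)) (past_pos N d (s * s))
    rw [markedSeq_mul_self] at this
    simp only [past, markedSeq_mul_self]
    linarith
  have hpos : 0 < blockLimit (codeSeq N d) := by linarith [one_le_blockLimit (codeSeq N d)]
  have hc : ContinuousAt acMap (blockLimit (codeSeq N d)) := by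
    have : √2 * blockLimit (codeSeq N d) + 1 ≠ 0 := by positivity
    unfold acMap; fun_prop (disch := assumption)
  have := (hc.tendsto.comp hX).add (hY.inv₀ one_ne_zero)
  rwa [inv_one] at this

/-- The upper bound holds at every orbit vector; the lower bound uses the vectors reached after the
markers, where the quotient equals the height exactly. -/
theorem lagrangeNumber_codeForm (hN : 0 < N) :
    lagrangeNumber (heckeGroup 4) (codeForm N d) = ENNReal.ofReal (codeValue N d) := by
  have hD := one_add_acMap_pos N d
  have hl : 0 < codeValue N d := by linarith [sqrt_two_add_one_lt_codeValue N d, sqrt_two_gt]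
  unfold lagrangeNumber
  rw [sqrt_disc_codeForm]
  apply le_antisymm
  · refine limsup_le_of_le (by isBoundedDefault) (Eventually.of_forall fun v => ?_)
    have h1 := le_codeValue_mul_abs_eval N d hN v.2
    have h2 : 0 < |(codeForm N d).eval v| := by
      by_contra hcon
      nlinarith
    rw [← ENNReal.ofReal_div_of_pos h2]
    apply ENNReal.ofReal_le_ofReal
    rwa [div_le_iff₀ h2]
  · refine le_of_forall_lt_imp_le_of_dense fun η hη => ?_
    have hηt : η ≠ ⊤ := ne_top_of_lt hη
    have hη' : η.toReal < codeValue N d := by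
      rwa [← ENNReal.lt_ofReal_iff_toReal_lt hηt]
    refine le_limsup_of_frequently_le ?_ (by isBoundedDefault)
    intro hcon
    rw [eventually_cofinite] at hcon
    simp only [not_not] at hcon
    -- Finitely many exceptions would have bounded first coordinates, but the vector reached at time
    -- s² + 1 has first coordinate at least s² + 1.
    obtain ⟨R, hR⟩ := (hcon.image fun v : cuspOrbit (heckeGroup 4) => (v : Fin 2 → ℝ) 0).bddAbove
    obtain ⟨n, hn⟩ := exists_nat_gt R
    obtain ⟨s, hs1, hs2⟩ := (((tendsto_height N d).eventually (lt_mem_nhds hη')).and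
      (eventually_ge_atTop n)).exists
    obtain ⟨M, hM, -, h2, -, -, -, h6⟩ := reaches_codeForm N d (s * s + 1)
    have hv : Matrix.mulVec (M : Matrix (Fin 2) (Fin 2) ℝ) ![1, 0] ∈ cuspOrbit (heckeGroup 4) :=
      ⟨M, hM, rfl⟩
    have h7 := h6 ![1, 0]
    simp only [Matrix.cons_val_zero, Matrix.cons_val_one, Matrix.cons_val_fin_one, mul_zero,
      sub_zero, add_zero, mul_one] at h7
    set H := acMap (future N d (s * s + 1)) + (past N d (s * s + 1))⁻¹ with hH
    have hHpos : 0 < H := by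
      have := inv_pos.2 (past_pos N d (s * s + 1))
      linarith [one_le_acMap (future_pos N d (s * s + 1))]
    have heval : (codeForm N d).eval (Matrix.mulVec (M : Matrix (Fin 2) (Fin 2) ℝ) ![1, 0]) =
        (1 + acMap (future N d 0)) / H := by
      rw [eq_div_iff hHpos.ne', h7]
    have hmem := hR ⟨⟨_, hv⟩, (by
      change η ≤ _
      dsimp only
      rw [heval, abs_of_pos (by positivity), ← ENNReal.ofReal_div_of_pos (by positivity),
        div_div_cancel₀ hD.ne', ENNReal.le_ofReal_iff_toReal_le hηt hHpos.le]
      exact hs1.le), rfl⟩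
    dsimp only at hmem
    rw [mulVec_zero] at hmem
    simp only [Matrix.cons_val_zero, Matrix.cons_val_one, Matrix.cons_val_fin_one, mul_zero,
      add_zero, mul_one] at hmem
    have h8 : (n : ℝ) ≤ ((s * s + 1 : ℕ) : ℝ) := by
      exact_mod_cast hs2.trans (by nlinarith)
    linarith

theorem codeValue_mem_lagrangeSpectrum (hN : 0 < N) :
    codeValue N d ∈ lagrangeSpectrum (heckeGroup 4) := by
  refine ⟨by linarith [sqrt_two_add_one_lt_codeValue N d, sqrt_two_gt], codeForm N d, ?_,
    hasNonCuspidalZero_codeForm N d, lagrangeNumber_codeForm N d hN⟩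
  rw [disc_codeForm]
  exact pow_pos (one_add_acMap_pos N d) 2

end codeForm

end HeckeSpectra

/-! ### Positive Hausdorff dimension near 2√2 -/

namespace HeckeSpectra

open Filter Topology

lemma le_abs_codeValue_sub (N n : ℕ) {d e : ℕ → Fin 2} (h : ∀ i < n, d i = e i)
    (hn : d n ≠ e n) :
    betaRatio ^ (N + 2) / 432 * (betaRatio ^ (N + 2) / 144) ^ (n + 1) ≤
      |codeValue N d - codeValue N e| := by
  -- The digit d n is the exponent at place n + 1, since place 0 always holds N.
  have h1 := le_abs_blockLimit_sub (n + 1) (codeSeq_le N d) (codeSeq_le N e) (fun i hi => by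
    cases i with
    | zero => rfl
    | succ i => simp only [codeSeq]; rw [h i (by omega)])
    (fun hcon => hn (by simp only [codeSeq] at hcon; exact Fin.ext (by omega)))
  have h2 : ∀ {x y : ℝ}, 1 ≤ x → x ≤ 3 → 1 ≤ y → y ≤ 3 → |x - y| / 36 ≤ |acMap x - acMap y| := by
    intro x y hx hx3 hy hy3
    rcases le_total y x with hxy | hxy
    · rw [abs_of_nonneg (sub_nonneg.2 hxy)]
      exact (le_acMap_sub hx3 hy hxy).trans (le_abs_self _)
    · rw [abs_sub_comm, abs_sub_comm (acMap x), abs_of_nonneg (sub_nonneg.2 hxy)]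
      exact (le_acMap_sub hy3 hx hxy).trans (le_abs_self _)
  have h3 := h2 (one_le_blockLimit (codeSeq N d)) (blockLimit_le_three _)
    (one_le_blockLimit (codeSeq N e)) (blockLimit_le_three _)
  unfold codeValue
  rw [add_sub_add_right_eq_sub]
  refine le_trans ?_ h3
  linarith

/-- A family of reals indexed by binary sequences, in which sequences that first differ at the
`n`-th place are at least `c * q ^ n` apart, has positive Hausdorff dimension. -/
theorem dimH_range_pos_of_separated {g : (ℕ → Fin 2) → ℝ} {c q : ℝ} (hc : 0 < c) (hq : 0 < q)
    (hq1 : q < 1)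
    (h : ∀ (n : ℕ) (d e : ℕ → Fin 2), (∀ i < n, d i = e i) → d n ≠ e n →
      c * q ^ n ≤ |g d - g e|) : 0 < dimH (Set.range g) := by
  have hfirst : ∀ d e : ℕ → Fin 2, d ≠ e → ∃ n, (∀ i < n, d i = e i) ∧ d n ≠ e n := by
    intro d e hde
    have hex : ∃ n, d n ≠ e n := Function.ne_iff.1 hde
    exact ⟨Nat.find hex, fun i hi => not_not.1 (Nat.find_min hex hi), Nat.find_spec hex⟩
  have hinj : Function.Injective g := by
    intro d e hde
    by_contra hne
    obtain ⟨n, h1, h2⟩ := hfirst d e hne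
    have := h n d e h1 h2
    rw [hde, sub_self, abs_zero] at this
    have : 0 < c * q ^ n := by positivity
    linarith
  -- The Hölder exponent is chosen so that q ^ r = 1/2, matching the scale of binary digits.
  set r : ℝ := Real.log 2 / -Real.log q with hr
  have hlogq : Real.log q < 0 := Real.log_neg hq hq1
  have hr0 : 0 < r := div_pos (Real.log_pos one_lt_two) (by linarith)
  have hqr : q ^ r = 2⁻¹ := by
    rw [Real.rpow_def_of_pos hq, ← Real.exp_log (by norm_num : (0 : ℝ) < 2⁻¹), Real.log_inv, hr]
    congr 1
    have : Real.log q ≠ 0 := hlogq.ne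
    field_simp
  let F : ℝ → ℝ := fun x => Real.ofDigits (Function.invFun g x)
  have hFg : ∀ d, F (g d) = Real.ofDigits d := fun d => by
    simp only [F, Function.leftInverse_invFun hinj d]
  have hcr : 0 < c ^ r := Real.rpow_pos_of_pos hc r
  have hholder : HolderOnWith ((c ^ r)⁻¹).toNNReal r.toNNReal F (Set.range g) := by
    rintro _ ⟨d, rfl⟩ _ ⟨e, rfl⟩
    rw [hFg, hFg, Real.coe_toNNReal r hr0.le, edist_dist, edist_dist,
      ENNReal.ofReal_rpow_of_nonneg dist_nonneg hr0.le, show (((c ^ r)⁻¹).toNNReal : ℝ≥0∞) = ENNReal.ofReal (c ^ r)⁻¹ from rfl,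
      ← ENNReal.ofReal_mul (by positivity)]
    apply ENNReal.ofReal_le_ofReal
    by_cases hde : d = e
    · rw [hde, dist_self]; positivity
    obtain ⟨n, h1, h2⟩ := hfirst d e hde
    have h3 := Real.abs_ofDigits_sub_ofDigits_le h1
    have h4 := Real.rpow_le_rpow (by positivity) (h n d e h1 h2) hr0.le
    rw [Real.mul_rpow hc.le (by positivity), ← Real.rpow_natCast, ← Real.rpow_mul hq.le,
      mul_comm (n : ℝ), Real.rpow_mul hq.le, hqr, Real.rpow_natCast, inv_pow] at h4
    rw [Real.dist_eq, Real.dist_eq]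
    refine h3.trans ?_
    rw [le_inv_mul_iff₀ hcr]
    exact_mod_cast h4
  have himg : Set.Icc (0 : ℝ) 1 ⊆ F '' Set.range g := by
    intro y hy
    obtain ⟨d, -, hd⟩ := Real.ofDigits_SurjOn one_lt_two hy
    exact ⟨g d, ⟨d, rfl⟩, by rw [hFg, hd]⟩
  have h1 : dimH (Set.Icc (0 : ℝ) 1) = 1 := by
    rw [Real.dimH_of_nonempty_interior (by rw [interior_Icc]; exact ⟨1 / 2, by norm_num⟩)]
    simp
  have h2 := (dimH_mono himg).trans (hholder.dimH_image_le (by simpa using hr0))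
  rw [h1] at h2
  rw [pos_iff_ne_zero]
  intro h0
  rw [h0] at h2
  simp at h2

/-- The leading exponent N puts the expansion within 4 `betaRatio ^ N` of 1, and `acMap` does not
expand distances. -/
lemma exists_codeValue_lt {ε : ℝ} (hε : 0 < ε) :
    ∃ N, 0 < N ∧ ∀ d, codeValue N d < 2 * √2 + ε := by
  obtain ⟨N, hN1, hN2⟩ := ((tendsto_betaRatio_pow.eventually
    (gt_mem_nhds (by positivity : 0 < ε / 4))).and (eventually_gt_atTop 0)).exists
  refine ⟨N, hN2, fun d => ?_⟩
  have h1 := one_le_blockLimit (codeSeq N d)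
  have h2 := acMap_sub_le zero_le_one h1
  have h3 := blockMap_sub_one_le (codeSeq N d 0)
    (by linarith [one_le_blockLimit fun i => codeSeq N d (i + 1)] :
      0 < blockLimit fun i => codeSeq N d (i + 1))
  rw [← blockLimit_eq] at h3
  have h4 : codeSeq N d 0 = N := rfl
  rw [h4] at h3
  rw [acMap_one] at h2
  unfold codeValue
  linarith

theorem dimH_lagrangeSpectrum_pos {ε : ℝ} (hε : 0 < ε) :
    0 < dimH (lagrangeSpectrum (heckeGroup 4) ∩ Set.Ico 0 (2 * √2 + ε)) := by
  obtain ⟨N, hN, hlt⟩ := exists_codeValue_lt hε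
  have hb := betaRatio_pow_pos (N + 2)
  have hb1 := betaRatio_pow_le_one (N + 2)
  have hpos : 0 < dimH (Set.range (codeValue N)) := by
    refine dimH_range_pos_of_separated (c := betaRatio ^ (N + 2) / 432 *
      (betaRatio ^ (N + 2) / 144)) (q := betaRatio ^ (N + 2) / 144) (by positivity)
      (by positivity) (by linarith) fun n d e h1 h2 => ?_
    rw [mul_assoc, ← pow_succ']
    exact le_abs_codeValue_sub N n h1 h2
  refine hpos.trans_le (dimH_mono ?_)
  rintro _ ⟨d, rfl⟩
  have h1 := codeValue_mem_lagrangeSpectrum N d hN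
  exact ⟨h1, h1.1, hlt d⟩

end HeckeSpectra

theorem mainTheorem3 (ε : ℝ) (hε : 0 < ε) :
    dimH (HeckeSpectra.markoffSpectrum (HeckeSpectra.heckeGroup 4) ∩
        Set.Ico 0 (2 * Real.sqrt 2 + ε)) ≥
      dimH (HeckeSpectra.lagrangeSpectrum (HeckeSpectra.heckeGroup 4) ∩
        Set.Ico 0 (2 * Real.sqrt 2 + ε)) ∧
    dimH (HeckeSpectra.lagrangeSpectrum (HeckeSpectra.heckeGroup 4) ∩
        Set.Ico 0 (2 * Real.sqrt 2 + ε)) > 0 :=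
  ⟨HeckeSpectra.dimH_lagrangeSpectrum_inter_le _ fun _ hx => hx.1,
    HeckeSpectra.dimH_lagrangeSpectrum_pos hε⟩
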